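/- **Theorem 3 (SSLS under a suboptimal transformation).** Let $(Z_i,\mathbf V_i)\in\mathbb R\times\mathbb R^{q}$, $i=1,2,\dots$, be i.i.d. with law $P$, let $f^*:\mathbb R\times\mathbb R^q\to\mathbb R$ and $g^*:\mathbb R^q\to\mathbb R^d$ be measurable, let $\boldsymbol\beta\in\mathbb R^d$, and put $Z_i^*=f^*(Z_i,\mathbf V_i)$, $\mathbf V_i^*=g^*(\mathbf V_i)$, $\epsilon_i=Z_i^*-\mathbf V_i^{*\top}\boldsymbol\beta$. *Estimator.* For every even $N$, split $\{1,\dots,N\}$ at random, independently of the data, into disjoint $\mathcal I_1,\mathcal I_2$ with $|\mathcal I_1|=|\mathcal I_2|=N/2$. For $k=1,2$ let $\widehat f_k:\mathbb R\times\mathbb R^q\to\mathbb R$ and $\widehat g_k:\mathbb R^q\to\mathbb R^d$ be computed (jointly measurably) from the observations with index in $\mathcal I_k^C=\{1,\dots,N\}\setminus\mathcal I_k$, and put $\widehat Z_{ki}=\widehat f_k(Z_i,\mathbf V_i)$, $\widehat{\mathbf V}_{ki}=\widehat g_k(\mathbf V_i)$ for $i\in\mathcal I_k$. The SSLS estimator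 is $$\widehat{\boldsymbol\beta}_{\rm SSLS}=\Big(\sum_{k=1}^2\sum_{i\in\mathcal I_k}\widehat{\mathbf V}_{ki}\widehat{\mathbf V}_{ki}^\top\Big)^{-1}\Big(\sum_{k=1}^2\sum_{i\in\mathcal I_k}\widehat{\mathbf V}_{ki}\widehat Z_{ki}\Big).$$ *Assumptions.* Write $\|h\|_{P,r}=\big(\int\|h\|_2^r\,dP\big)^{1/r}$, where estimated functions are held fixed. Suppose $E(\epsilon_i\mathbf V_i^*)=0$ and, for $k=1,2$, (a) $E\|\mathbf V_i^*\|_2^4<\infty$, $E\|\mathbf V_i^*\epsilon_i\|_2^4<\infty$, $E(\epsilon_i^2\mid\mathbf V_i^*)$ is bounded by a constant almost surely, and $E(\mathbf V_i^*\mathbf V_i^{*\top})$ has full rank; (b) $\|\widehat g_k\|_{P,4}$ is bounded in probability as $N\to\infty$; (c) $\|\widehat f_k-f^*\|_{P,2}\to0$ and $\|\widehat g_k-g^*\|_{P,2}\to0$ in probability as $N\to\infty$; (d) $\sqrt N\,\big\|E\big[\widehat g_k(\mathbf V)\{\widehat f_k(Z,\mathbf V)-\widehat g_k(\mathbf V)^\top\boldsymbol\beta\}\,\big|\,\mathcal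 I_k^C\big]\big\|_2\to0$, where $(Z,\mathbf V)\sim P$ is a fresh observation and the training sample with index set $\mathcal I_k^C$ is held fixed, and $\big\|\widehat g_k(\widehat f_k-\widehat g_k^\top\boldsymbol\beta)-g^*(f^*-g^{*\top}\boldsymbol\beta)\big\|_{P,2}\to0$, both in probability as $N\to\infty$. *Conclusion.* As $N\to\infty$ through the even integers, the matrix inverted in $\widehat{\boldsymbol\beta}_{\rm SSLS}$ is invertible with probability tending to one, and $$\sqrt N\big(\widehat{\boldsymbol\beta}_{\rm SSLS}-\boldsymbol\beta\big)\xrightarrow{D}N(0,\Sigma'),\qquad \Sigma'=E(\mathbf V_i^*\mathbf V_i^{*\top})^{-1}E(\epsilon_i^2\mathbf V_i^*\mathbf V_i^{*\top})E(\mathbf V_i^*\mathbf V_i^{*\top})^{-1}.$$ Moreover, with $\widehat\epsilon_{ki}=\widehat Z_{ki}-\widehat{\mathbf V}_{ki}^\top\widehat{\boldsymbol\beta}_{\rm SSLS}$, the plug-in estimate $$\widehat\Sigma'=\Big(\frac1N\sum_{k=1}^2\sum_{i\in\mathcal I_k}\widehat{\mathbf V}_{ki}\widehat{\mathbf V}_{ki}^\top\Big)^{-1}\Big(\frac1N\sum_{k=1}^2\sum_{i\in\mathcal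 I_k}\widehat\epsilon_{ki}^{\,2}\widehat{\mathbf V}_{ki}\widehat{\mathbf V}_{ki}^\top\Big)\Big(\frac1N\sum_{k=1}^2\sum_{i\in\mathcal I_k}\widehat{\mathbf V}_{ki}\widehat{\mathbf V}_{ki}^\top\Big)^{-1}$$ converges to $\Sigma'$ in probability (in spectral norm), and the asymptotic normality holds with the plug-in estimate: if $\Sigma'$ is invertible, then $\sqrt N\,(\widehat\Sigma')^{-1/2}\big(\widehat{\boldsymbol\beta}_{\rm SSLS}-\boldsymbol\beta\big)\xrightarrow{D}N(0,I_d)$. (Inverses of singular matrices, which occur with probability tending to zero, may be replaced by $0$.) -/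

import Mathlib

open MeasureTheory ProbabilityTheory Filter Topology
open scoped ENNReal NNReal Matrix MatrixOrder Matrix.Norms.L2Operator

noncomputable section

namespace SSLS

/-- Real vectors with the Euclidean norm. -/
abbrev Vec (m : ℕ) : Type := EuclideanSpace ℝ (Fin m)

/-- One observation `(Z, V)`: an outcome `Z ∈ ℝ` and raw regressors `V ∈ ℝ^q`. -/
abbrev Obs (q : ℕ) : Type := ℝ × Vec q

/-- The matrix `x xᵀ`. -/
def outer {d : ℕ} (x : Vec d) : Matrix (Fin d) (Fin d) ℝ := Matrix.vecMulVec x x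

/-! ### Population quantities

`μ` is the law of one observation, `fs` and `gs` are the true transformations `f*` and `g*`. -/

section Population

variable {q d : ℕ}

/-- The residual `f(z, v) - g(v)ᵀ β`; for `f = f*`, `g = g*` this is the error `ε`. -/
def resid (f : Obs q → ℝ) (g : Vec q → Vec d) (β : Vec d) (w : Obs q) : ℝ :=
  f w - inner ℝ (g w.2) β

/-- The summand `g(v) (f(z, v) - g(v)ᵀ β)` of the normal equations. -/
def score (f : Obs q → ℝ) (g : Vec q → Vec d) (β : Vec d) (w : Obs q) : Vec d :=
  resid f g β w • g w.2

/-- The second-moment matrix `E(V* V*ᵀ)`. -/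
def popGram (μ : Measure (Obs q)) (gs : Vec q → Vec d) : Matrix (Fin d) (Fin d) ℝ :=
  Matrix.of fun i j => ∫ w, outer (gs w.2) i j ∂μ

/-- The matrix `E(ε² V* V*ᵀ)`. -/
def popMeat (μ : Measure (Obs q)) (fs : Obs q → ℝ) (gs : Vec q → Vec d) (β : Vec d) :
    Matrix (Fin d) (Fin d) ℝ :=
  Matrix.of fun i j => ∫ w, resid fs gs β w ^ 2 * outer (gs w.2) i j ∂μ

/-- The sandwich covariance `E(V* V*ᵀ)⁻¹ E(ε² V* V*ᵀ) E(V* V*ᵀ)⁻¹`. -/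
def popSandwich (μ : Measure (Obs q)) (fs : Obs q → ℝ) (gs : Vec q → Vec d) (β : Vec d) :
    Matrix (Fin d) (Fin d) ℝ :=
  (popGram μ gs)⁻¹ * popMeat μ fs gs β * (popGram μ gs)⁻¹

end Population

/-! ### Sample splitting and the estimator -/

section Sample

variable {N q d : ℕ}

/-- A split of `{1, …, N}` into two folds is a labelling of the indices by two labels;
`fold lab k` is the subsample carrying label `k`. -/
def fold (lab : Fin N → Fin 2) (k : Fin 2) : Finset (Fin N) :=
  Finset.univ.filter fun i => lab i = k

/-- An estimation procedure for a function `X → Y`: from an index set `T` and the observations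
with index in `T` (and nothing else) it produces a function `X → Y`. -/
abbrev Learner (N q : ℕ) (X Y : Type) : Type :=
  (T : Finset (Fin N)) → (T → Obs q) → X → Y

/-- The function produced for fold `k`, trained on the complement of fold `k`. -/
def crossFit {X Y : Type} (A : Fin 2 → Learner N q X Y) (lab : Fin N → Fin 2)
    (w : Fin N → Obs q) (k : Fin 2) : X → Y :=
  A k (fold lab k)ᶜ fun i => w i

/-- `∑ₖ ∑_{i ∈ Iₖ} V̂ₖᵢ V̂ₖᵢᵀ`, for functions `g k` applied on the folds. -/
def gramSum (g : Fin 2 → Vec q → Vec d) (lab : Fin N → Fin 2) (w : Fin N → Obs q) :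
    Matrix (Fin d) (Fin d) ℝ :=
  ∑ k, ∑ i ∈ fold lab k, outer (g k (w i).2)

/-- `∑ₖ ∑_{i ∈ Iₖ} V̂ₖᵢ Ẑₖᵢ`. -/
def crossSum (f : Fin 2 → Obs q → ℝ) (g : Fin 2 → Vec q → Vec d) (lab : Fin N → Fin 2)
    (w : Fin N → Obs q) : Vec d :=
  ∑ k, ∑ i ∈ fold lab k, f k (w i) • g k (w i).2

/-- Least squares on the transformed variables, pooled over both folds. -/
def betaHat (f : Fin 2 → Obs q → ℝ) (g : Fin 2 → Vec q → Vec d) (lab : Fin N → Fin 2)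
    (w : Fin N → Obs q) : Vec d :=
  WithLp.toLp 2 ((gramSum g lab w)⁻¹ *ᵥ (crossSum f g lab w : Fin d → ℝ))

/-- `∑ₖ ∑_{i ∈ Iₖ} ε̂ₖᵢ² V̂ₖᵢ V̂ₖᵢᵀ` with residuals `ε̂ₖᵢ = Ẑₖᵢ - V̂ₖᵢᵀ β̂`. -/
def meatSum (f : Fin 2 → Obs q → ℝ) (g : Fin 2 → Vec q → Vec d) (lab : Fin N → Fin 2)
    (w : Fin N → Obs q) : Matrix (Fin d) (Fin d) ℝ :=
  ∑ k, ∑ i ∈ fold lab k,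
    resid (f k) (g k) (betaHat f g lab w) (w i) ^ 2 • outer (g k (w i).2)

/-- The plug-in covariance estimate. -/
def sandwichHat (f : Fin 2 → Obs q → ℝ) (g : Fin 2 → Vec q → Vec d) (lab : Fin N → Fin 2)
    (w : Fin N → Obs q) : Matrix (Fin d) (Fin d) ℝ :=
  ((N : ℝ)⁻¹ • gramSum g lab w)⁻¹ * ((N : ℝ)⁻¹ • meatSum f g lab w) *
    ((N : ℝ)⁻¹ • gramSum g lab w)⁻¹

end Sample

/-! ### Stochastic order symbols, for extended nonnegative random variables -/

/-- `X n` converges to `0` in probability, i.e. `X n = o_P(1)`. -/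
def VanishesInProbability {Ω : Type*} [MeasurableSpace Ω] (P : Measure Ω)
    (X : ℕ → Ω → ℝ≥0∞) : Prop :=
  ∀ ε : ℝ≥0∞, 0 < ε → Tendsto (fun n => P {ω | ε ≤ X n ω}) atTop (𝓝 0)

/-- `X n` is bounded in probability, i.e. `X n = O_P(1)`. -/
def BoundedInProbability {Ω : Type*} [MeasurableSpace Ω] (P : Measure Ω)
    (X : ℕ → Ω → ℝ≥0∞) : Prop :=
  ∀ δ : ℝ≥0∞, 0 < δ → ∃ C : ℝ≥0, ∀ᶠ n in atTop, P {ω | (C : ℝ≥0∞) < X n ω} ≤ δ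

end SSLS

end

namespace SSLS

/-! ### Convergence in probability -/

section Convergence

variable {Ω : Type*} [MeasurableSpace Ω] {P : Measure Ω}

/-- Continuous mapping theorem for convergence in probability to a constant, on a set that
carries all the variables. -/
lemma tendstoInMeasure_comp_continuousWithinAt {E F : Type*} [PseudoEMetricSpace E]
    [PseudoEMetricSpace F] {X : ℕ → Ω → E} {c : E} {s : Set E} {φ : E → F}
    (hX : TendstoInMeasure P X atTop fun _ => c) (hs : ∀ n ω, X n ω ∈ s)
    (hφ : ContinuousWithinAt φ s c) :
    TendstoInMeasure P (fun n ω => φ (X n ω)) atTop fun _ => φ c := by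
  intro ε hε
  obtain ⟨δ, hδ, h⟩ := EMetric.tendsto_nhdsWithin_nhds.1 hφ ε hε
  refine tendsto_of_tendsto_of_tendsto_of_le_of_le tendsto_const_nhds (hX δ hδ)
    (fun _ => zero_le) fun n => measure_mono fun ω hω => ?_
  by_contra hlt
  exact absurd (h (hs n ω) (not_le.1 hlt)) (not_lt.2 hω)

lemma tendstoInMeasure_comp_continuousAt {E F : Type*} [PseudoEMetricSpace E]
    [PseudoEMetricSpace F] {X : ℕ → Ω → E} {c : E} {φ : E → F}
    (hX : TendstoInMeasure P X atTop fun _ => c) (hφ : ContinuousAt φ c) :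
    TendstoInMeasure P (fun n ω => φ (X n ω)) atTop fun _ => φ c :=
  tendstoInMeasure_comp_continuousWithinAt hX (fun _ _ => Set.mem_univ _) hφ.continuousWithinAt

lemma tendstoInMeasure_prodMk {E F : Type*} [PseudoEMetricSpace E]
    [PseudoEMetricSpace F] {X : ℕ → Ω → E} {Y : ℕ → Ω → F} {c : E} {c' : F}
    (hX : TendstoInMeasure P X atTop fun _ => c) (hY : TendstoInMeasure P Y atTop fun _ => c') :
    TendstoInMeasure P (fun n ω => (X n ω, Y n ω)) atTop fun _ => (c, c') := by
  intro ε hε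
  refine tendsto_of_tendsto_of_tendsto_of_le_of_le tendsto_const_nhds
    (by simpa using (hX ε hε).add (hY ε hε)) (fun _ => zero_le) fun n =>
      (measure_mono fun ω hω => ?_).trans (measure_union_le _ _)
  simpa [Prod.edist_eq] using hω

lemma tendstoInMeasure_pi {ι : Type*} [Fintype ι] {E : ι → Type*} [∀ i, PseudoEMetricSpace (E i)]
    {X : ℕ → Ω → ∀ i, E i} {c : ∀ i, E i}
    (hX : ∀ i, TendstoInMeasure P (fun n ω => X n ω i) atTop fun _ => c i) :
    TendstoInMeasure P X atTop fun _ => c := by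
  intro ε hε
  have hsum : Tendsto (fun n => ∑ i, P {ω | ε ≤ edist (X n ω i) (c i)}) atTop (𝓝 0) := by
    simpa using tendsto_finsetSum Finset.univ fun i _ => hX i ε hε
  refine tendsto_of_tendsto_of_tendsto_of_le_of_le tendsto_const_nhds hsum
    (fun _ => zero_le) fun n => (measure_mono fun ω hω => ?_).trans (measure_iUnion_fintype_le _ _)
  by_contra hcon
  simp only [Set.mem_iUnion, Set.mem_ofPred_eq, not_exists, not_le] at hcon
  exact absurd ((Finset.sup_lt_iff (by simpa using hε)).2 fun i _ => hcon i) (not_lt.2 hω)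

/-- Domination outside events of vanishing probability. -/
lemma tendstoInMeasure_of_le_off {E : Type*} [PseudoEMetricSpace E] {X : ℕ → Ω → E} {c : E}
    {Y : ℕ → Ω → ℝ} {B : ℕ → Set Ω} (hY : TendstoInMeasure P Y atTop fun _ => 0)
    (hB : Tendsto (fun n => P (B n)) atTop (𝓝 0))
    (h : ∀ᶠ n in atTop, ∀ ω, ω ∉ B n → edist (X n ω) c ≤ ENNReal.ofReal (Y n ω)) :
    TendstoInMeasure P X atTop fun _ => c := by
  intro ε hε
  refine tendsto_of_tendsto_of_tendsto_of_le_of_le' tendsto_const_nhds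
    (by simpa using (hY ε hε).add hB) (Eventually.of_forall fun _ => zero_le) ?_
  filter_upwards [h] with n hn
  refine (measure_mono fun ω hω => ?_).trans (measure_union_le _ _)
  by_cases hb : ω ∈ B n
  · exact Or.inr hb
  · refine Or.inl (le_trans hω ((hn ω hb).trans ?_))
    rw [← ofReal_norm]
    exact ENNReal.ofReal_le_ofReal (le_abs_self _)

/-- Equality outside events of vanishing probability. -/
lemma tendstoInMeasure_congr_off {E : Type*} [PseudoEMetricSpace E] {X Y : ℕ → Ω → E} {c : E}
    {B : ℕ → Set Ω} (hY : TendstoInMeasure P Y atTop fun _ => c)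
    (hB : Tendsto (fun n => P (B n)) atTop (𝓝 0))
    (h : ∀ᶠ n in atTop, ∀ ω, ω ∉ B n → X n ω = Y n ω) :
    TendstoInMeasure P X atTop fun _ => c := by
  intro ε hε
  refine tendsto_of_tendsto_of_tendsto_of_le_of_le' tendsto_const_nhds
    (by simpa using (hY ε hε).add hB) (Eventually.of_forall fun _ => zero_le) ?_
  filter_upwards [h] with n hn
  refine (measure_mono fun ω hω => ?_).trans (measure_union_le _ _)
  by_cases hb : ω ∈ B n
  · exact Or.inr hb
  · left
    simpa [← hn ω hb] using hω

lemma VanishesInProbability.mono {X Y : ℕ → Ω → ℝ≥0∞} (hX : VanishesInProbability P X)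
    (h : ∀ n ω, Y n ω ≤ X n ω) : VanishesInProbability P Y := fun ε hε =>
  tendsto_of_tendsto_of_tendsto_of_le_of_le tendsto_const_nhds (hX ε hε)
    (fun _ => zero_le) fun n => measure_mono fun ω hω => le_trans hω (h n ω)

lemma VanishesInProbability.pow {X : ℕ → Ω → ℝ≥0∞} (hX : VanishesInProbability P X) {p : ℕ}
    (hp : p ≠ 0) : VanishesInProbability P fun n ω => X n ω ^ p := by
  intro ε hε
  have hp' : (0 : ℝ) < p := by positivity
  refine tendsto_of_tendsto_of_tendsto_of_le_of_le tendsto_const_nhds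
    (hX (ε ^ ((p : ℝ)⁻¹)) (ENNReal.rpow_pos_of_nonneg hε (by positivity)))
    (fun _ => zero_le) fun n => measure_mono fun ω hω => ?_
  have hω' : ε ≤ X n ω ^ p := hω
  rw [← ENNReal.rpow_natCast] at hω'
  exact (ENNReal.rpow_inv_le_iff hp').2 hω'

lemma VanishesInProbability.add {X Y : ℕ → Ω → ℝ≥0∞} (hX : VanishesInProbability P X)
    (hY : VanishesInProbability P Y) : VanishesInProbability P fun n ω => X n ω + Y n ω := by
  intro ε hε
  have hε2 : 0 < ε / 2 := ENNReal.half_pos hε.ne'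
  refine tendsto_of_tendsto_of_tendsto_of_le_of_le tendsto_const_nhds
    (by simpa using (hX _ hε2).add (hY _ hε2)) (fun _ => zero_le) fun n =>
      (measure_mono fun ω hω => ?_).trans (measure_union_le _ _)
  by_contra hcon
  simp only [Set.mem_union, Set.mem_ofPred_eq, not_or, not_le] at hcon
  exact absurd (ENNReal.add_lt_add hcon.1 hcon.2) (by simpa [ENNReal.add_halves] using hω)

lemma BoundedInProbability.pow {X : ℕ → Ω → ℝ≥0∞} (hX : BoundedInProbability P X) (p : ℕ) :
    BoundedInProbability P fun n ω => X n ω ^ p := by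
  intro δ hδ
  obtain ⟨C, hC⟩ := hX δ hδ
  refine ⟨C ^ p, ?_⟩
  filter_upwards [hC] with n hn
  refine (measure_mono fun ω hω => ?_).trans hn
  by_contra hcon
  have : X n ω ^ p ≤ (C : ℝ≥0∞) ^ p := by gcongr; exact not_lt.1 hcon
  simp only [Set.mem_ofPred_eq, ENNReal.coe_pow] at hω
  exact absurd hω (not_lt.2 this)

lemma BoundedInProbability.mono {X Y : ℕ → Ω → ℝ≥0∞} (hX : BoundedInProbability P X)
    (h : ∀ n ω, Y n ω ≤ X n ω) : BoundedInProbability P Y := by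
  intro δ hδ
  obtain ⟨C, hC⟩ := hX δ hδ
  refine ⟨C, ?_⟩
  filter_upwards [hC] with n hn
  exact (measure_mono fun ω hω => lt_of_lt_of_le hω (h n ω)).trans hn

lemma BoundedInProbability.add {X Y : ℕ → Ω → ℝ≥0∞} (hX : BoundedInProbability P X)
    (hY : BoundedInProbability P Y) : BoundedInProbability P fun n ω => X n ω + Y n ω := by
  intro δ hδ
  obtain ⟨C, hC⟩ := hX (δ / 2) (ENNReal.half_pos hδ.ne')
  obtain ⟨C', hC'⟩ := hY (δ / 2) (ENNReal.half_pos hδ.ne')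
  refine ⟨C + C', ?_⟩
  filter_upwards [hC, hC'] with n hn hn'
  calc P {ω | ((C + C' : ℝ≥0) : ℝ≥0∞) < X n ω + Y n ω}
      ≤ P ({ω | (C : ℝ≥0∞) < X n ω} ∪ {ω | (C' : ℝ≥0∞) < Y n ω}) := by
        refine measure_mono fun ω hω => ?_
        by_contra hcon
        simp only [Set.mem_union, Set.mem_ofPred_eq, not_or, not_lt] at hcon
        simp only [Set.mem_ofPred_eq, ENNReal.coe_add] at hω
        exact absurd hω (not_lt.2 (add_le_add hcon.1 hcon.2))
    _ ≤ δ / 2 + δ / 2 := (measure_union_le _ _).trans (add_le_add hn hn')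
    _ = δ := ENNReal.add_halves δ

/-- A product of a bounded and a vanishing factor vanishes. -/
lemma BoundedInProbability.mul_vanishes {X Y : ℕ → Ω → ℝ≥0∞} (hX : BoundedInProbability P X)
    (hY : VanishesInProbability P Y) : VanishesInProbability P fun n ω => X n ω * Y n ω := by
  intro ε hε
  refine ENNReal.tendsto_nhds_zero.2 fun δ hδ => ?_
  obtain ⟨C, hC⟩ := hX (δ / 2) (ENNReal.half_pos hδ.ne')
  have hpos : 0 < ε / (C + 1 : ℝ≥0) := ENNReal.div_pos hε.ne' ENNReal.coe_ne_top
  filter_upwards [hC, ENNReal.tendsto_nhds_zero.1 (hY _ hpos) (δ / 2) (ENNReal.half_pos hδ.ne')]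
    with n hn hn'
  calc P {ω | ε ≤ X n ω * Y n ω}
      ≤ P ({ω | (C : ℝ≥0∞) < X n ω} ∪ {ω | ε / (C + 1 : ℝ≥0) ≤ Y n ω}) := by
        refine measure_mono fun ω hω => ?_
        by_cases hx : (C : ℝ≥0∞) < X n ω
        · exact Or.inl hx
        · refine Or.inr (ENNReal.div_le_of_le_mul' (le_trans hω ?_))
          gcongr
          exact (not_lt.1 hx).trans (by exact_mod_cast le_self_add)
    _ ≤ δ / 2 + δ / 2 := (measure_union_le _ _).trans (add_le_add hn hn')
    _ = δ := ENNReal.add_halves δ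

lemma VanishesInProbability.tendstoInMeasure {X : ℕ → Ω → ℝ}
    (hX : VanishesInProbability P fun n ω => ENNReal.ofReal |X n ω|) :
    TendstoInMeasure P X atTop fun _ => 0 := by
  intro ε hε
  simpa [edist_zero_right, ← ofReal_norm] using hX ε hε

lemma vanishesInProbability_of_tendstoInMeasure {E : Type*} [SeminormedAddCommGroup E]
    {X : ℕ → Ω → E} (hX : TendstoInMeasure P X atTop fun _ => 0) :
    VanishesInProbability P fun n ω => ‖X n ω‖ₑ := by
  intro ε hε
  simpa [edist_zero_right] using hX ε hε

/-- If the probability that `X n ≤ δ` and `ε ≤ R n` is at most `δ / ε`, then `R n` vanishes as soon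
as `X n` does. -/
lemma VanishesInProbability.of_markov {X R : ℕ → Ω → ℝ≥0∞} (hX : VanishesInProbability P X)
    (h : ∀ n (δ ε : ℝ≥0), 0 < ε → P {ω | X n ω ≤ δ ∧ ε ≤ R n ω} ≤ δ / ε) :
    VanishesInProbability P R := by
  intro ε hε
  obtain ⟨ε', hε'0, hε'⟩ : ∃ ε' : ℝ≥0, 0 < ε' ∧ (ε' : ℝ≥0∞) ≤ ε := by
    obtain ⟨r, hr0, hr⟩ := ENNReal.lt_iff_exists_nnreal_btwn.1 hε
    exact ⟨r, by exact_mod_cast hr0, hr.le⟩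
  refine ENNReal.tendsto_nhds_zero.2 fun η hη => ?_
  obtain ⟨η', hη'0, hη'⟩ : ∃ ε' : ℝ≥0, 0 < ε' ∧ (ε' : ℝ≥0∞) < η / 2 := by
    obtain ⟨r, hr0, hr⟩ := ENNReal.lt_iff_exists_nnreal_btwn.1 (ENNReal.half_pos hη.ne')
    exact ⟨r, by exact_mod_cast hr0, hr⟩
  have hpos : (0 : ℝ≥0∞) < ((ε' * η' : ℝ≥0) : ℝ≥0∞) := by
    exact_mod_cast mul_pos hε'0 hη'0
  filter_upwards [ENNReal.tendsto_nhds_zero.1 (hX _ hpos) (η / 2) (ENNReal.half_pos hη.ne')]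
    with n hn
  calc P {ω | ε ≤ R n ω}
      ≤ P ({ω | X n ω ≤ (ε' * η' : ℝ≥0) ∧ ε' ≤ R n ω} ∪
          {ω | ((ε' * η' : ℝ≥0) : ℝ≥0∞) ≤ X n ω}) := by
        refine measure_mono fun ω hω => ?_
        rcases le_total (X n ω) (ε' * η' : ℝ≥0) with hle | hle
        · exact Or.inl ⟨hle, hε'.trans hω⟩
        · exact Or.inr hle
    _ ≤ η / 2 + η / 2 := by
        refine (measure_union_le _ _).trans (add_le_add ((h n _ _ hε'0).trans ?_) hn)
        refine le_trans (ENNReal.div_le_of_le_mul' ?_) hη'.le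
        rw [ENNReal.coe_mul]
    _ = η := ENNReal.add_halves η

lemma BoundedInProbability.of_markov {X R : ℕ → Ω → ℝ≥0∞} (hX : BoundedInProbability P X)
    (h : ∀ n (δ ε : ℝ≥0), 0 < ε → P {ω | X n ω ≤ δ ∧ ε ≤ R n ω} ≤ δ / ε) :
    BoundedInProbability P R := by
  intro η hη
  obtain ⟨C, hC⟩ := hX (η / 2) (ENNReal.half_pos hη.ne')
  obtain ⟨η', hη'0, hη'⟩ : ∃ ε' : ℝ≥0, 0 < ε' ∧ (ε' : ℝ≥0∞) < η / 2 := by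
    obtain ⟨r, hr0, hr⟩ := ENNReal.lt_iff_exists_nnreal_btwn.1 (ENNReal.half_pos hη.ne')
    exact ⟨r, by exact_mod_cast hr0, hr⟩
  refine ⟨(C + 1) / η', ?_⟩
  have hpos : 0 < (C + 1) / η' := by positivity
  filter_upwards [hC] with n hn
  calc P {ω | (((C + 1) / η' : ℝ≥0) : ℝ≥0∞) < R n ω}
      ≤ P ({ω | X n ω ≤ C ∧ ((C + 1) / η' : ℝ≥0) ≤ R n ω} ∪ {ω | (C : ℝ≥0∞) < X n ω}) := by
        refine measure_mono fun ω hω => ?_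
        rcases le_or_gt (X n ω) C with hle | hlt
        · exact Or.inl ⟨hle, le_of_lt hω⟩
        · exact Or.inr hlt
    _ ≤ η / 2 + η / 2 := by
        refine (measure_union_le _ _).trans (add_le_add ((h n _ _ hpos).trans ?_) hn)
        refine le_trans ?_ hη'.le
        rw [← ENNReal.coe_div hpos.ne']
        refine ENNReal.coe_le_coe.2 (div_le_of_le_mul₀ zero_le zero_le ?_)
        rw [mul_div_cancel₀ _ hη'0.ne']
        exact le_self_add
    _ = η := ENNReal.add_halves η

end Convergence

/-! ### Conditional moment inequalities for sample splitting -/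

section Split

variable {Ω α ι : Type*} [MeasurableSpace Ω] [MeasurableSpace α] {P : Measure Ω}
  [IsProbabilityMeasure P] {μ : Measure α}

lemma map_subfamily_eq_pi {W : ι → Ω → α} (hlaw : ∀ i, HasLaw (W i) μ P)
    (hindep : iIndepFun W P) (S : Finset ι) :
    P.map (fun ω (i : S) => W i ω) = Measure.pi fun _ => μ := by
  have h := (iIndepFun_iff_map_fun_eq_pi_map (f := fun (i : S) => W i)
    (fun i => (hlaw i).aemeasurable)).1 (hindep.precomp Subtype.val_injective)
  rw [h]
  congr 1
  ext1 i
  exact (hlaw i).map_eq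

/-- Fubini for an independent sample that is split into two subsamples. -/
lemma lintegral_split [Fintype ι] [DecidableEq ι] {W : ι → Ω → α}
    (hlaw : ∀ i, HasLaw (W i) μ P) (hindep : iIndepFun W P) (T : Finset ι)
    {H : (↥Tᶜ → α) × (T → α) → ℝ≥0∞} (hH : Measurable H) :
    ∫⁻ ω, H (fun i => W i ω, fun i => W i ω) ∂P =
      ∫⁻ x, ∫⁻ y, H (x, y) ∂(Measure.pi fun _ => μ) ∂(Measure.pi fun _ => μ) := by
  have hae (S : Finset ι) : AEMeasurable (fun ω (i : S) => W i ω) P :=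
    aemeasurable_pi_lambda _ fun i => (hlaw i).aemeasurable
  have hpair := (indepFun_iff_map_prod_eq_prod_map_map (hae Tᶜ) (hae T)).1
    (hindep.indepFun_finset₀ Tᶜ T disjoint_compl_left fun i => (hlaw i).aemeasurable)
  have h1 : IsProbabilityMeasure (Measure.pi fun _ : T => μ) := by
    rw [← map_subfamily_eq_pi hlaw hindep T]
    exact Measure.isProbabilityMeasure_map (hae T)
  rw [map_subfamily_eq_pi hlaw hindep, map_subfamily_eq_pi hlaw hindep] at hpair
  rw [← lintegral_prod _ hH.aemeasurable, ← hpair,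
    lintegral_map' hH.aemeasurable ((hae Tᶜ).prodMk (hae T))]

/-- Markov's inequality conditionally on the training sample, for a random split. -/
theorem measure_crossFit_markov {N : ℕ} {W : Fin N → Ω → α}
    (hlaw : ∀ i, HasLaw (W i) μ P) (hindep : iIndepFun W P)
    {lab : Ω → Fin N → Fin 2} (hlab : Measurable lab)
    (hlab_indep : IndepFun lab (fun ω i => W i ω) P) (k : Fin 2)
    {X : ∀ T : Finset (Fin N), (↥Tᶜ → α) → ℝ≥0∞} (hX : ∀ T, Measurable (X T))
    {Φ : ∀ T : Finset (Fin N), (↥Tᶜ → α) × (T → α) → ℝ≥0∞} (hΦ : ∀ T, Measurable (Φ T))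
    (h : ∀ ω x, ∫⁻ y, Φ (fold (lab ω) k) (x, y) ∂(Measure.pi fun _ => μ) ≤ X (fold (lab ω) k) x)
    (δ ε : ℝ≥0) (hε : 0 < ε) :
    P {ω | X (fold (lab ω) k) (fun i => W i ω) ≤ δ ∧
      ε ≤ Φ (fold (lab ω) k) (fun i => W i ω, fun i => W i ω)} ≤ δ / ε := by
  set B : Finset (Fin N) → Set (Fin N → α) := fun T =>
    {w | X T (fun i => w i) ≤ δ ∧ ε ≤ Φ T (fun i => w i, fun i => w i)} with hB
  have hBmeas (T) : MeasurableSet (B T) := by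
    refine MeasurableSet.inter ?_ ?_
    · exact measurableSet_le ((hX T).comp (by fun_prop)) measurable_const
    · exact measurableSet_le measurable_const ((hΦ T).comp (by fun_prop))
  have hbound (ω₀ : Ω) : P {ω | (fun i => W i ω) ∈ B (fold (lab ω₀) k)} ≤ δ / ε := by
    set T := fold (lab ω₀) k
    set H : (↥Tᶜ → α) × (T → α) → ℝ≥0∞ := {p | X T p.1 ≤ δ}.indicator (Φ T) with hH
    have hS : MeasurableSet {p : (↥Tᶜ → α) × (T → α) | X T p.1 ≤ δ} :=
      measurableSet_le ((hX T).comp measurable_fst) measurable_const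
    have hHmeas : Measurable H := (hΦ T).indicator hS
    have hint : ∫⁻ ω, H (fun i => W i ω, fun i => W i ω) ∂P ≤ δ := by
      rw [lintegral_split hlaw hindep T hHmeas]
      have hpr : IsProbabilityMeasure (Measure.pi fun _ : ↥Tᶜ => μ) := by
        rw [← map_subfamily_eq_pi hlaw hindep Tᶜ]
        exact Measure.isProbabilityMeasure_map
          (aemeasurable_pi_lambda _ fun i => (hlaw i).aemeasurable)
      calc _ ≤ ∫⁻ _, (δ : ℝ≥0∞) ∂(Measure.pi fun _ : ↥Tᶜ => μ) := by
            refine lintegral_mono fun x => ?_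
            by_cases hx : X T x ≤ δ
            · exact le_trans (lintegral_mono fun y => Set.indicator_le_self _ _ _)
                ((h ω₀ x).trans hx)
            · simp [hH, hx]
        _ = δ := by simp
    have hae : AEMeasurable (fun ω => H (fun i => W i ω, fun i => W i ω)) P := by
      refine hHmeas.comp_aemeasurable (AEMeasurable.prodMk ?_ ?_) <;>
      exact aemeasurable_pi_lambda _ fun i => (hlaw i).aemeasurable
    refine le_trans (measure_mono fun ω hω => ?_)
      ((meas_ge_le_lintegral_div hae (by exact_mod_cast hε.ne') ENNReal.coe_ne_top).trans
        (ENNReal.div_le_div_right hint _))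
    have hω1 : X T (fun i => W i ω) ≤ δ := hω.1
    simpa [hH, Set.indicator, hω1] using hω.2
  calc _ ≤ P (⋃ ℓ : Fin N → Fin 2, lab ⁻¹' {ℓ} ∩ (fun ω i => W i ω) ⁻¹' B (fold ℓ k)) := by
        refine measure_mono fun ω hω => Set.mem_iUnion.2 ⟨lab ω, rfl, hω⟩
    _ ≤ ∑ ℓ, P (lab ⁻¹' {ℓ} ∩ (fun ω i => W i ω) ⁻¹' B (fold ℓ k)) :=
        measure_iUnion_fintype_le _ _
    _ ≤ ∑ ℓ, P (lab ⁻¹' {ℓ}) * (δ / ε) := by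
        refine Finset.sum_le_sum fun ℓ _ => ?_
        rw [hlab_indep.measure_inter_preimage_eq_mul _ _ (measurableSet_singleton ℓ) (hBmeas _)]
        by_cases hℓ : ∃ ω₀, lab ω₀ = ℓ
        · obtain ⟨ω₀, rfl⟩ := hℓ
          gcongr
          exact hbound ω₀
        · have : lab ⁻¹' {ℓ} = ∅ := by
            ext ω
            simpa using fun h => hℓ ⟨ω, h⟩
          simp [this]
    _ = δ / ε := by
        rw [← Finset.sum_mul]
        have : ∑ ℓ, P (lab ⁻¹' {ℓ}) = 1 := by
          rw [sum_measure_preimage_singleton _ fun ℓ _ => hlab (measurableSet_singleton ℓ)]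
          simp
        rw [this, one_mul]

lemma lintegral_sum_pi [IsProbabilityMeasure μ] [Fintype ι] {φ : α → ℝ≥0∞} (hφ : Measurable φ) :
    ∫⁻ y, ∑ i : ι, φ (y i) ∂(Measure.pi fun _ => μ) = Fintype.card ι * ∫⁻ w, φ w ∂μ := by
  rw [lintegral_finsetSum _ fun i _ => by fun_prop]
  simp_rw [(measurePreserving_eval (fun _ : ι => μ) _).lintegral_comp hφ]
  simp

/-- The centred sum of `m` independent copies of `h` has second moment at most `m E h²`. -/
lemma lintegral_centred_sum_sq_le [IsProbabilityMeasure μ] [Fintype ι] {h : α → ℝ}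
    (hh : Measurable h) :
    ∫⁻ y, ‖∑ i : ι, (h (y i) - ∫ w, h w ∂μ)‖ₑ ^ 2 ∂(Measure.pi fun _ => μ) ≤
      Fintype.card ι * ∫⁻ w, ‖h w‖ₑ ^ 2 ∂μ := by
  rcases isEmpty_or_nonempty ι with hι | hι
  · simp
  by_cases hfin : ∫⁻ w, ‖h w‖ₑ ^ 2 ∂μ = ∞
  · rw [hfin, ENNReal.mul_top (by simp)]
    exact le_top
  have hL2 : MemLp h 2 μ := by
    refine ⟨hh.aestronglyMeasurable, ?_⟩
    rw [eLpNorm_lt_top_iff_lintegral_rpow_enorm_lt_top two_ne_zero ENNReal.ofNat_ne_top]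
    simpa using lt_top_iff_ne_top.2 hfin
  have hev (i : ι) := measurePreserving_eval (fun _ : ι => μ) i
  have hLi (i : ι) : MemLp (fun y : ι → α => h (y i)) 2 (Measure.pi fun _ => μ) :=
    hL2.comp_measurePreserving (hev i)
  have hmean (i : ι) : ∫ y : ι → α, h (y i) ∂(Measure.pi fun _ => μ) = ∫ w, h w ∂μ := by
    have := integral_map (hev i).measurable.aemeasurable
      (hh.aestronglyMeasurable (μ := (Measure.pi fun _ : ι => μ).map (Function.eval i)))
    rw [(hev i).map_eq] at this
    exact this.symm
  have hind : iIndepFun (fun (i : ι) (y : ι → α) => h (y i)) (Measure.pi fun _ => μ) :=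
    iIndepFun_pi fun _ => hh.aemeasurable
  have hvar := IndepFun.variance_sum (s := Finset.univ) (fun i _ => hLi i)
    fun i _ j _ hij => hind.indepFun hij
  have hsum : MemLp (∑ i : ι, fun y : ι → α => h (y i)) 2 (Measure.pi fun _ => μ) :=
    memLp_finsetSum' _ fun i _ => hLi i
  have hvari (i : ι) : Var[fun y : ι → α => h (y i); Measure.pi fun _ => μ] = Var[h; μ] := by
    have := variance_map (X := h) (μ := Measure.pi fun _ : ι => μ) (Y := Function.eval i)
      hh.aemeasurable (hev i).measurable.aemeasurable
    rw [(hev i).map_eq] at this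
    exact this.symm
  calc _ = evariance (∑ i : ι, fun y : ι → α => h (y i)) (Measure.pi fun _ => μ) := by
        rw [evariance]
        congr with y
        simp only [Finset.sum_apply]
        rw [integral_finsetSum _ fun i _ => (hLi i).integrable one_le_two]
        simp_rw [hmean, Finset.sum_sub_distrib]
    _ = ENNReal.ofReal (∑ i : ι, Var[h; μ]) := by
        rw [← ofReal_variance hsum, hvar]
        simp_rw [hvari]
    _ = Fintype.card ι * evariance h μ := by
        rw [← ofReal_variance hL2]
        simp [ENNReal.ofReal_mul]
    _ ≤ _ := by
        gcongr
        rw [← ofReal_variance hL2]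
        have h2 : ∫⁻ w, ‖h w‖ₑ ^ 2 ∂μ = ENNReal.ofReal (∫ w, h w ^ 2 ∂μ) := by
          rw [ofReal_integral_eq_lintegral_ofReal hL2.integrable_sq
            (Eventually.of_forall fun w => sq_nonneg _)]
          congr with w
          rw [← ofReal_norm, ← ENNReal.ofReal_pow (norm_nonneg _), Real.norm_eq_abs, sq_abs]
        rw [h2]
        exact ENNReal.ofReal_le_ofReal (variance_le_expectation_sq hL2.aestronglyMeasurable)

end Split

/-! ### Averages of cross-fitted functions -/

section CrossFit

lemma sum_fold {N : ℕ} {M : Type*} [AddCommMonoid M] (lab : Fin N → Fin 2)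
    (a : Fin 2 → Fin N → M) : ∑ k, ∑ i ∈ fold lab k, a k i = ∑ i, a (lab i) i := by
  rw [← Finset.sum_fiberwise Finset.univ lab fun i => a (lab i) i]
  refine Finset.sum_congr rfl fun k _ => Finset.sum_congr rfl fun i hi => ?_
  rw [(Finset.mem_filter.1 hi).2]

variable {Ω : Type*} [MeasurableSpace Ω] {P : Measure Ω} [IsProbabilityMeasure P] {q : ℕ}
  {μ : Measure (Obs q)} [IsProbabilityMeasure μ] {W : ℕ → Ω → Obs q}

section OneSample

variable {n : ℕ} {lab : Ω → Fin (2 * n) → Fin 2}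

/-- Conditional Markov inequality for the average over one fold. -/
lemma measure_foldAverage_le (hlaw : ∀ i, HasLaw (W i) μ P) (hindep : iIndepFun W P)
    (hlab : Measurable lab) (hcard : ∀ ω k, (fold (lab ω) k).card = n)
    (hlab_indep : IndepFun lab (fun ω (i : Fin (2 * n)) => W i ω) P)
    {E : Type} [NormedAddCommGroup E] [MeasurableSpace E] [BorelSpace E]
    {A : Fin 2 → Learner (2 * n) q (Obs q) E}
    (hA : ∀ k T, Measurable (Function.uncurry (A k T))) (p : ℕ) (k : Fin 2)
    (δ ε : ℝ≥0) (hε : 0 < ε) :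
    P {ω | ∫⁻ w, ‖crossFit A (lab ω) (fun i => W i ω) k w‖ₑ ^ p ∂μ ≤ δ ∧
      ε ≤ (n : ℝ≥0∞)⁻¹ * ∑ i ∈ fold (lab ω) k,
        ‖crossFit A (lab ω) (fun i => W i ω) k (W i ω)‖ₑ ^ p} ≤ δ / ε := by
  have key := measure_crossFit_markov (P := P) (μ := μ) (W := fun i : Fin (2 * n) => W i)
    (fun i => hlaw i) (hindep.precomp Fin.val_injective) hlab hlab_indep k
    (X := fun T x => ∫⁻ w, ‖A k Tᶜ x w‖ₑ ^ p ∂μ)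
    (fun T => (((hA k Tᶜ).enorm).pow_const p).lintegral_prod_right')
    (Φ := fun T z => (n : ℝ≥0∞)⁻¹ * ∑ i : T, ‖A k Tᶜ z.1 (z.2 i)‖ₑ ^ p)
    (fun T => Measurable.const_mul (Finset.measurable_sum _ fun i _ =>
      (((hA k Tᶜ).comp (f := fun z : (↥Tᶜ → Obs q) × (T → Obs q) => (z.1, z.2 i))
        (by fun_prop)).enorm).pow_const p) _)
    (fun ω x => ?_) δ ε hε
  · refine (measure_mono ?_).trans key
    intro ω hω
    refine ⟨hω.1, hω.2.trans_eq ?_⟩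
    congr 1
    exact (Finset.sum_coe_sort (fold (lab ω) k) fun i =>
      ‖crossFit A (lab ω) (fun i => W i ω) k (W i ω)‖ₑ ^ p).symm
  · have hm : Measurable fun w => ‖A k (fold (lab ω) k)ᶜ x w‖ₑ ^ p :=
      (((hA k _).comp (measurable_prodMk_left (x := x))).enorm).pow_const p
    set φ := fun w => ‖A k (fold (lab ω) k)ᶜ x w‖ₑ ^ p
    change ∫⁻ y : fold (lab ω) k → Obs q, (n : ℝ≥0∞)⁻¹ * ∑ i, φ (y i) ∂_ ≤ ∫⁻ w, φ w ∂μ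
    rw [lintegral_const_mul _ (Finset.measurable_sum _ fun i _ => by fun_prop),
      lintegral_sum_pi hm, ← mul_assoc, Fintype.card_coe, hcard]
    exact mul_le_of_le_one_left zero_le (ENNReal.inv_mul_le_one _)

/-- Conditional Chebyshev inequality for the centred sum over one fold. -/
lemma measure_foldCentredSum_le (hlaw : ∀ i, HasLaw (W i) μ P) (hindep : iIndepFun W P)
    (hlab : Measurable lab) (hcard : ∀ ω k, (fold (lab ω) k).card = n)
    (hlab_indep : IndepFun lab (fun ω (i : Fin (2 * n)) => W i ω) P)
    {A : Fin 2 → Learner (2 * n) q (Obs q) ℝ}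
    (hA : ∀ k T, Measurable (Function.uncurry (A k T))) (k : Fin 2)
    (δ ε : ℝ≥0) (hε : 0 < ε) :
    P {ω | ∫⁻ w, ‖crossFit A (lab ω) (fun i => W i ω) k w‖ₑ ^ 2 ∂μ ≤ δ ∧
      ε ≤ (n : ℝ≥0∞)⁻¹ * ‖∑ i ∈ fold (lab ω) k,
        (crossFit A (lab ω) (fun i => W i ω) k (W i ω) -
          ∫ w, crossFit A (lab ω) (fun i => W i ω) k w ∂μ)‖ₑ ^ 2} ≤ δ / ε := by
  have hmean (T : Finset (Fin (2 * n))) : Measurable fun x => ∫ w, A k Tᶜ x w ∂μ :=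
    ((hA k Tᶜ).stronglyMeasurable.integral_prod_right').measurable
  have key := measure_crossFit_markov (P := P) (μ := μ) (W := fun i : Fin (2 * n) => W i)
    (fun i => hlaw i) (hindep.precomp Fin.val_injective) hlab hlab_indep k
    (X := fun T x => ∫⁻ w, ‖A k Tᶜ x w‖ₑ ^ 2 ∂μ)
    (fun T => (((hA k Tᶜ).enorm).pow_const 2).lintegral_prod_right')
    (Φ := fun T z => (n : ℝ≥0∞)⁻¹ * ‖∑ i : T, (A k Tᶜ z.1 (z.2 i) - ∫ w, A k Tᶜ z.1 w ∂μ)‖ₑ ^ 2)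
    (fun T => Measurable.const_mul ((Finset.measurable_sum _ fun i _ =>
      ((hA k Tᶜ).comp (f := fun z : (↥Tᶜ → Obs q) × (T → Obs q) => (z.1, z.2 i))
        (by fun_prop)).sub ((hmean T).comp measurable_fst)).enorm.pow_const 2) _)
    (fun ω x => ?_) δ ε hε
  · refine (measure_mono ?_).trans key
    intro ω hω
    refine ⟨hω.1, hω.2.trans_eq ?_⟩
    congr 3
    exact (Finset.sum_coe_sort (fold (lab ω) k) fun i =>
      (crossFit A (lab ω) (fun i => W i ω) k (W i ω) -
          ∫ w, crossFit A (lab ω) (fun i => W i ω) k w ∂μ)).symm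
  · have hm : Measurable (A k (fold (lab ω) k)ᶜ x) :=
      (hA k _).comp (measurable_prodMk_left (x := x))
    set h := A k (fold (lab ω) k)ᶜ x
    change ∫⁻ y : fold (lab ω) k → Obs q,
      (n : ℝ≥0∞)⁻¹ * ‖∑ i, (h (y i) - ∫ w, h w ∂μ)‖ₑ ^ 2 ∂_ ≤ ∫⁻ w, ‖h w‖ₑ ^ 2 ∂μ
    have hsum : Measurable fun y : fold (lab ω) k → Obs q =>
        ‖∑ i, (h (y i) - ∫ w, h w ∂μ)‖ₑ ^ 2 :=
      (Finset.measurable_sum _ fun i _ =>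
        (hm.comp (measurable_pi_apply i)).sub_const _).enorm.pow_const 2
    rw [lintegral_const_mul _ hsum]
    refine (mul_le_mul_right (lintegral_centred_sum_sq_le hm) _).trans ?_
    rw [Fintype.card_coe, hcard, ← mul_assoc]
    exact mul_le_of_le_one_left zero_le (ENNReal.inv_mul_le_one _)

end OneSample

variable {lab : ∀ n : ℕ, Ω → Fin (2 * n) → Fin 2}

lemma ofReal_average_le {n : ℕ} {E : Type*} [NormedAddCommGroup E] (ℓ : Fin (2 * n) → Fin 2)
    (a : Fin 2 → Fin (2 * n) → E) (p : ℕ) :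
    ENNReal.ofReal (((2 * n : ℕ) : ℝ)⁻¹ * ∑ i, ‖a (ℓ i) i‖ ^ p) ≤
      ∑ k, (n : ℝ≥0∞)⁻¹ * ∑ i ∈ fold ℓ k, ‖a k i‖ₑ ^ p := by
  rcases Nat.eq_zero_or_pos n with rfl | hn
  · simp
  rw [← Finset.mul_sum, sum_fold ℓ fun k i => ‖a k i‖ₑ ^ p, ENNReal.ofReal_mul (by positivity),
    ENNReal.ofReal_sum_of_nonneg fun i _ => by positivity]
  refine mul_le_mul' ?_ (Finset.sum_le_sum fun i _ => ?_)
  · rw [ENNReal.ofReal_inv_of_pos (by positivity), ENNReal.ofReal_natCast, ENNReal.inv_le_inv]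
    exact_mod_cast (by omega : n ≤ 2 * n)
  · rw [ENNReal.ofReal_pow (norm_nonneg _), ofReal_norm]

/-- The sample average of `‖a‖ ^ p`, for cross-fitted functions `a` whose conditional `p`-th
moment vanishes in probability, vanishes in probability. -/
theorem crossFitAverage_tendsto_zero (hlaw : ∀ i, HasLaw (W i) μ P) (hindep : iIndepFun W P)
    (hlab : ∀ n, Measurable (lab n)) (hcard : ∀ n ω k, (fold (lab n ω) k).card = n)
    (hlab_indep : ∀ n, IndepFun (lab n) (fun ω (i : Fin (2 * n)) => W i ω) P)
    {E : Type} [NormedAddCommGroup E] [MeasurableSpace E] [BorelSpace E]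
    {A : ∀ n, Fin 2 → Learner (2 * n) q (Obs q) E}
    (hA : ∀ n k T, Measurable (Function.uncurry (A n k T))) (p : ℕ)
    (hvan : ∀ k, VanishesInProbability P fun n ω =>
      ∫⁻ w, ‖crossFit (A n) (lab n ω) (fun i => W i ω) k w‖ₑ ^ p ∂μ) :
    TendstoInMeasure P (fun n ω => ((2 * n : ℕ) : ℝ)⁻¹ *
      ∑ i : Fin (2 * n), ‖crossFit (A n) (lab n ω) (fun i => W i ω) (lab n ω i) (W i ω)‖ ^ p)
      atTop fun _ => 0 := by
  refine VanishesInProbability.tendstoInMeasure ?_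
  have h (k) := (hvan k).of_markov fun n δ ε hε => measure_foldAverage_le hlaw hindep (hlab n)
    (hcard n) (hlab_indep n) (hA n) p k δ ε hε
  refine ((h 0).add (h 1)).mono fun n ω => ?_
  rw [abs_of_nonneg (by positivity)]
  refine (ofReal_average_le (lab n ω)
    (fun k i => crossFit (A n) (lab n ω) (fun i => W i ω) k (W i ω)) p).trans_eq ?_
  rw [Fin.sum_univ_two]

theorem crossFitAverage_bounded (hlaw : ∀ i, HasLaw (W i) μ P) (hindep : iIndepFun W P)
    (hlab : ∀ n, Measurable (lab n)) (hcard : ∀ n ω k, (fold (lab n ω) k).card = n)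
    (hlab_indep : ∀ n, IndepFun (lab n) (fun ω (i : Fin (2 * n)) => W i ω) P)
    {E : Type} [NormedAddCommGroup E] [MeasurableSpace E] [BorelSpace E]
    {A : ∀ n, Fin 2 → Learner (2 * n) q (Obs q) E}
    (hA : ∀ n k T, Measurable (Function.uncurry (A n k T))) (p : ℕ)
    (hbdd : ∀ k, BoundedInProbability P fun n ω =>
      ∫⁻ w, ‖crossFit (A n) (lab n ω) (fun i => W i ω) k w‖ₑ ^ p ∂μ) :
    BoundedInProbability P fun n ω => ENNReal.ofReal (((2 * n : ℕ) : ℝ)⁻¹ *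
      ∑ i : Fin (2 * n), ‖crossFit (A n) (lab n ω) (fun i => W i ω) (lab n ω i) (W i ω)‖ ^ p) := by
  have h (k) := (hbdd k).of_markov fun n δ ε hε => measure_foldAverage_le hlaw hindep (hlab n)
    (hcard n) (hlab_indep n) (hA n) p k δ ε hε
  refine ((h 0).add (h 1)).mono fun n ω => ?_
  refine (ofReal_average_le (lab n ω)
    (fun k i => crossFit (A n) (lab n ω) (fun i => W i ω) k (W i ω)) p).trans_eq ?_
  rw [Fin.sum_univ_two]

/-- The normalized sum of cross-fitted real functions whose conditional second moment vanishes and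
whose conditional mean is `o_P(N^{-1/2})` vanishes in probability. -/
theorem crossFitSum_tendsto_zero (hlaw : ∀ i, HasLaw (W i) μ P) (hindep : iIndepFun W P)
    (hlab : ∀ n, Measurable (lab n)) (hcard : ∀ n ω k, (fold (lab n ω) k).card = n)
    (hlab_indep : ∀ n, IndepFun (lab n) (fun ω (i : Fin (2 * n)) => W i ω) P)
    {A : ∀ n, Fin 2 → Learner (2 * n) q (Obs q) ℝ}
    (hA : ∀ n k T, Measurable (Function.uncurry (A n k T)))
    (hvan : ∀ k, VanishesInProbability P fun n ω =>
      ∫⁻ w, ‖crossFit (A n) (lab n ω) (fun i => W i ω) k w‖ₑ ^ 2 ∂μ)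
    (hmean : ∀ k, TendstoInMeasure P (fun n ω => √((2 * n : ℕ) : ℝ) *
      ∫ w, crossFit (A n) (lab n ω) (fun i => W i ω) k w ∂μ) atTop fun _ => 0) :
    TendstoInMeasure P (fun n ω => (√((2 * n : ℕ) : ℝ))⁻¹ *
      ∑ i : Fin (2 * n), crossFit (A n) (lab n ω) (fun i => W i ω) (lab n ω i) (W i ω))
      atTop fun _ => 0 := by
  set c : ℕ → Ω → Fin 2 → Obs q → ℝ := fun n ω => crossFit (A n) (lab n ω) (fun i => W i ω) with hc
  set m : ℕ → Ω → Fin 2 → ℝ := fun n ω k => ∫ w, c n ω k w ∂μ with hm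
  have hcheb (k : Fin 2) : TendstoInMeasure P (fun n ω => (√((2 * n : ℕ) : ℝ))⁻¹ *
      ∑ i ∈ fold (lab n ω) k, (c n ω k (W i ω) - m n ω k)) atTop fun _ => 0 := by
    have h := (hvan k).of_markov fun n δ ε hε => measure_foldCentredSum_le hlaw hindep (hlab n)
      (hcard n) (hlab_indep n) (hA n) k δ ε hε
    refine VanishesInProbability.tendstoInMeasure ?_
    intro ε hε
    refine tendsto_of_tendsto_of_tendsto_of_le_of_le tendsto_const_nhds
      (h (ε ^ 2) (by positivity)) (fun _ => zero_le) fun n => measure_mono fun ω hω => ?_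
    have hω' : ε ≤ ENNReal.ofReal |(√((2 * n : ℕ) : ℝ))⁻¹ *
      ∑ i ∈ fold (lab n ω) k, (c n ω k (W i ω) - m n ω k)| := hω
    refine (pow_le_pow_left' hω' 2).trans ?_
    rcases Nat.eq_zero_or_pos n with rfl | hn
    · simp
    rw [abs_mul, ENNReal.ofReal_mul (abs_nonneg _), mul_pow, ← Real.norm_eq_abs (∑ i ∈ _, _),
      ofReal_norm]
    refine mul_le_mul' ?_ le_rfl
    rw [← ENNReal.ofReal_pow (abs_nonneg _), sq_abs, inv_pow, Real.sq_sqrt (by positivity),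
      ENNReal.ofReal_inv_of_pos (by positivity), ENNReal.ofReal_natCast, ENNReal.inv_le_inv]
    exact_mod_cast (by omega : n ≤ 2 * n)
  have hall : TendstoInMeasure P (fun n ω =>
      (((√((2 * n : ℕ) : ℝ))⁻¹ * ∑ i ∈ fold (lab n ω) 0, (c n ω 0 (W i ω) - m n ω 0),
        (√((2 * n : ℕ) : ℝ))⁻¹ * ∑ i ∈ fold (lab n ω) 1, (c n ω 1 (W i ω) - m n ω 1)),
        (√((2 * n : ℕ) : ℝ) * m n ω 0, √((2 * n : ℕ) : ℝ) * m n ω 1)))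
      atTop fun _ => (((0 : ℝ), (0 : ℝ)), ((0 : ℝ), (0 : ℝ))) :=
    tendstoInMeasure_prodMk (tendstoInMeasure_prodMk (hcheb 0) (hcheb 1))
      (tendstoInMeasure_prodMk (hmean 0) (hmean 1))
  have hφ := tendstoInMeasure_comp_continuousAt hall
    (φ := fun z : (ℝ × ℝ) × (ℝ × ℝ) => z.1.1 + z.1.2 + (z.2.1 + z.2.2) / 2) (by fun_prop)
  simp only [add_zero, zero_div] at hφ
  refine hφ.congr_left fun n => Eventually.of_forall fun ω => ?_
  simp only
  rw [← sum_fold (lab n ω) fun k i => c n ω k (W i ω), Fin.sum_univ_two]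
  simp only [Finset.sum_sub_distrib, Finset.sum_const, hcard, nsmul_eq_mul]
  rcases Nat.eq_zero_or_pos n with rfl | hn
  · simp
  have hN : (0 : ℝ) < ((2 * n : ℕ) : ℝ) := by positivity
  have hs : √((2 * n : ℕ) : ℝ) * √((2 * n : ℕ) : ℝ) = 2 * n := by
    rw [Real.mul_self_sqrt hN.le]; push_cast; ring
  have hs0 : √((2 * n : ℕ) : ℝ) ≠ 0 := (Real.sqrt_pos.2 hN).ne'
  have hinv : (√((2 * n : ℕ) : ℝ))⁻¹ * n = √((2 * n : ℕ) : ℝ) / 2 := by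
    rw [inv_mul_eq_iff_eq_mul₀ hs0]; linarith
  linear_combination -(m n ω 0 + m n ω 1) * hinv

end CrossFit

/-! ### Matrices -/

section Matrices

variable {d : ℕ}

lemma isUnit_det_of_rank_eq {A : Matrix (Fin d) (Fin d) ℝ} (h : A.rank = d) : IsUnit A.det := by
  rw [← Matrix.isUnit_iff_isUnit_det, ← Matrix.mulVec_surjective_iff_isUnit]
  have htop : LinearMap.range A.mulVecLin = ⊤ := by
    apply Submodule.eq_top_of_finrank_eq
    rw [← Matrix.rank, h]
    simp
  exact LinearMap.range_eq_top.1 htop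

lemma continuousAt_matrix_inv {A : Matrix (Fin d) (Fin d) ℝ} (h : IsUnit A.det) :
    ContinuousAt (fun B : Matrix (Fin d) (Fin d) ℝ => B⁻¹) A := by
  obtain ⟨u, rfl⟩ := (Matrix.isUnit_iff_isUnit_det A).2 h
  simp_rw [Matrix.nonsing_inv_eq_ringInverse]
  exact NormedRing.inverse_continuousAt u

/-- The matrix `∫ h hᵀ`. -/
noncomputable def secondMoment {α : Type*} [MeasurableSpace α] (μ : Measure α) (h : α → Vec d) :
    Matrix (Fin d) (Fin d) ℝ :=
  Matrix.of fun i j => ∫ w, outer (h w) i j ∂μ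

lemma outer_apply (x : Vec d) (i j : Fin d) : outer x i j = x i * x j := rfl

lemma outer_smul (c : ℝ) (x : Vec d) : outer (c • x) = c ^ 2 • outer x := by
  ext i j
  simp [outer_apply]
  ring

lemma outer_mulVec (x y : Vec d) : outer x *ᵥ y = (inner ℝ x y • x : Vec d) := by
  rw [outer, Matrix.vecMulVec_mulVec]
  ext i
  simp [PiLp.inner_apply, dotProduct, mul_comm]

lemma outer_posSemidef (x : Vec d) : (outer x).PosSemidef := by
  simpa [outer] using Matrix.posSemidef_vecMulVec_self_star (x : Fin d → ℝ)

lemma integrable_outer {α : Type*} [MeasurableSpace α] {μ : Measure α} {h : α → Vec d}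
    (hh : MemLp h 2 μ) (i j : Fin d) : Integrable (fun w => outer (h w) i j) μ :=
  ((hh.eval_piLp i).integrable_mul (hh.eval_piLp j) :)

lemma dotProduct_secondMoment {α : Type*} [MeasurableSpace α] {μ : Measure α} {h : α → Vec d}
    (hh : MemLp h 2 μ) (x : Vec d) :
    x ⬝ᵥ secondMoment μ h *ᵥ x = ∫ w, inner ℝ x (h w) ^ 2 ∂μ := by
  have hint := fun i j => integrable_outer hh i j
  simp only [dotProduct, Matrix.mulVec, secondMoment, Matrix.of_apply, Finset.mul_sum]
  have : ∀ w, inner ℝ x (h w) ^ 2 = ∑ i, ∑ j, x i * (outer (h w) i j * x j) := by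
    intro w
    simp only [PiLp.inner_apply, RCLike.inner_apply, conj_trivial, outer_apply, sq,
      Finset.sum_mul_sum]
    refine Finset.sum_congr rfl fun i _ => Finset.sum_congr rfl fun j _ => by ring
  simp_rw [this]
  rw [integral_finsetSum _ fun i _ => integrable_finsetSum _ fun j _ =>
    ((hint i j).mul_const _).const_mul _]
  refine Finset.sum_congr rfl fun i _ => ?_
  rw [integral_finsetSum _ fun j _ => ((hint i j).mul_const _).const_mul _]
  refine Finset.sum_congr rfl fun j _ => ?_
  rw [integral_const_mul, integral_mul_const]

lemma secondMoment_posSemidef {α : Type*} [MeasurableSpace α] {μ : Measure α} {h : α → Vec d}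
    (hh : MemLp h 2 μ) : (secondMoment μ h).PosSemidef := by
  refine Matrix.PosSemidef.of_dotProduct_mulVec_nonneg ?_ fun x => ?_
  · ext i j
    simp [secondMoment, outer_apply, mul_comm]
  · have := dotProduct_secondMoment hh (WithLp.toLp 2 x)
    simp only [star_trivial] at this ⊢
    rw [this]
    exact integral_nonneg fun w => sq_nonneg _

end Matrices

/-! ### Limit theorems -/

section Limit

variable {d : ℕ}

/-- A linear image of a centred Gaussian vector. -/
lemma map_toEuclideanCLM_multivariateGaussian {S : Matrix (Fin d) (Fin d) ℝ} (hS : S.PosSemidef)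
    (B : Matrix (Fin d) (Fin d) ℝ) :
    (multivariateGaussian 0 S).map (Matrix.toEuclideanCLM (𝕜 := ℝ) B) =
      multivariateGaussian 0 (B * S * Bᵀ) := by
  have hBSB : (B * S * Bᵀ).PosSemidef := by
    simpa [Matrix.conjTranspose_eq_transpose_of_trivial] using hS.mul_mul_conjTranspose_same B
  have : IsProbabilityMeasure
      ((multivariateGaussian 0 S).map (Matrix.toEuclideanCLM (𝕜 := ℝ) B)) :=
    Measure.isProbabilityMeasure_map (by fun_prop)
  refine Measure.ext_of_charFun (funext fun t => ?_)
  have h1 : charFun ((multivariateGaussian 0 S).map (Matrix.toEuclideanCLM (𝕜 := ℝ) B)) t =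
      charFun (multivariateGaussian 0 S) (WithLp.toLp 2 (Bᵀ *ᵥ t)) := by
    rw [charFun_apply, charFun_apply, integral_map (by fun_prop) (by fun_prop)]
    congr with x
    congr 3
    simp only [PiLp.inner_apply, RCLike.inner_apply, conj_trivial, Matrix.ofLp_toEuclideanCLM]
    change (t : Fin d → ℝ) ⬝ᵥ (B *ᵥ x) = (Bᵀ *ᵥ t) ⬝ᵥ x
    rw [Matrix.dotProduct_mulVec, Matrix.mulVec_transpose]
  rw [h1, charFun_multivariateGaussian hS, charFun_multivariateGaussian hBSB]
  simp only [inner_zero_right]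
  congr 4
  simp only [Matrix.dotProduct_mulVec, Matrix.mulVec_transpose, Matrix.vecMul_vecMul]
  rw [← Matrix.vecMul_vecMul t (B * S) Bᵀ, ← Matrix.dotProduct_mulVec (_ ᵥ* (B * S)),
    Matrix.mulVec_transpose]

lemma TendstoInDistribution.id_of_map_eq {Ω Ω' E : Type*} [MeasurableSpace Ω] [MeasurableSpace Ω']
    {P : Measure Ω} [IsProbabilityMeasure P] {P' : Measure Ω'} [IsProbabilityMeasure P']
    [TopologicalSpace E] [MeasurableSpace E] [OpensMeasurableSpace E]
    {ν : Measure E} [IsProbabilityMeasure ν]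
    {X : ℕ → Ω → E} {Z : Ω' → E}
    (h : TendstoInDistribution X atTop Z (fun _ => P) P') (hν : P'.map Z = ν) :
    TendstoInDistribution X atTop id (fun _ => P) ν where
  forall_aemeasurable := h.forall_aemeasurable
  tendsto := by
    subst hν
    simpa using h.tendsto

variable {Ω α : Type*} [MeasurableSpace Ω] [MeasurableSpace α] {P : Measure Ω}
  {μ : Measure α} {W : ℕ → Ω → α}

lemma identDistrib_comp (hlaw : ∀ i, HasLaw (W i) μ P) {E : Type*} [MeasurableSpace E]
    {s : α → E} (hs : Measurable s) (i : ℕ) :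
    IdentDistrib (fun ω => s (W i ω)) (fun ω => s (W 0 ω)) P P :=
  IdentDistrib.comp ⟨(hlaw i).aemeasurable, (hlaw 0).aemeasurable,
    (hlaw i).map_eq.trans (hlaw 0).map_eq.symm⟩ hs

lemma aemeasurable_smul_sum (hlaw : ∀ i, HasLaw (W i) μ P) {s : α → Vec d} (hs : Measurable s)
    (n : ℕ) (c : ℝ) : AEMeasurable (fun ω => c • ∑ i ∈ Finset.range n, s (W i ω)) P := by
  have h : AEMeasurable (fun ω => ∑ i ∈ Finset.range n, s (W i ω)) P :=
    Finset.aemeasurable_fun_sum _ fun i _ => hs.comp_aemeasurable (hlaw i).aemeasurable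
  exact h.const_smul c

variable [IsProbabilityMeasure P]

/-- The multivariate central limit theorem for centred functions of an i.i.d. sequence. -/
theorem tendstoInDistribution_inv_sqrt_smul_sum (hlaw : ∀ i, HasLaw (W i) μ P)
    (hindep : iIndepFun W P) {s : α → Vec d} (hs : Measurable s) (hL2 : MemLp s 2 μ)
    (h0 : ∫ w, s w ∂μ = 0) :
    TendstoInDistribution (fun (n : ℕ) ω => (√n)⁻¹ • ∑ i ∈ Finset.range n, s (W i ω)) atTop id
      (fun _ => P) (multivariateGaussian 0 (secondMoment μ s)) where
  forall_aemeasurable n := aemeasurable_smul_sum hlaw hs n _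
  tendsto := by
    have hμ : IsProbabilityMeasure μ := by
      rw [← (hlaw 0).map_eq]
      exact Measure.isProbabilityMeasure_map (hlaw 0).aemeasurable
    refine ProbabilityMeasure.tendsto_iff_tendsto_charFun.2 fun t => ?_
    have hmt : Measurable fun w => inner ℝ t (s w) := by fun_prop
    have hLt : MemLp (fun w => inner ℝ t (s w)) 2 μ := hL2.const_inner t
    have hmean : ∫ ω, inner ℝ t (s (W 0 ω)) ∂P = 0 := by
      rw [← integral_map (hlaw 0).aemeasurable hmt.aestronglyMeasurable, (hlaw 0).map_eq,
        integral_inner (hL2.integrable one_le_two), h0, inner_zero_right]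
    have hLt0 : MemLp (fun ω => inner ℝ t (s (W 0 ω))) 2 P := by
      have := (memLp_map_measure_iff (f := W 0) (g := fun w => inner ℝ t (s w)) (p := 2) (μ := P)
        (by rw [(hlaw 0).map_eq]; exact hmt.aestronglyMeasurable) (hlaw 0).aemeasurable).1
      rw [(hlaw 0).map_eq] at this
      exact this hLt
    have hvar : Var[fun ω => inner ℝ t (s (W 0 ω)); P] = t ⬝ᵥ secondMoment μ s *ᵥ t := by
      rw [dotProduct_secondMoment hL2, variance_of_integral_eq_zero hLt0.aemeasurable hmean,
        ← (hlaw 0).map_eq, integral_map (hlaw 0).aemeasurable (by fun_prop)]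
    set v := Var[fun ω => inner ℝ t (s (W 0 ω)); P] with hv
    have h1 := tendstoInDistribution_inv_sqrt_mul_sum_sub (Ω' := ℝ) (Y := id)
      (P' := gaussianReal 0 v.toNNReal) ⟨by fun_prop, Measure.map_id⟩
      (X := fun i ω => inner ℝ t (s (W i ω))) hLt0
      (hindep.comp (fun _ w => inner ℝ t (s w)) fun _ => hmt) (identDistrib_comp hlaw hmt)
    have h2 := ProbabilityMeasure.tendsto_iff_tendsto_charFun.1 h1.tendsto 1
    simp only [ProbabilityMeasure.coe_mk, Measure.map_id, charFun_gaussianReal] at h2 ⊢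
    rw [charFun_multivariateGaussian (secondMoment_posSemidef hL2), ← hvar]
    have hlim : Complex.exp ((1 : ℝ) * (0 : ℝ) * Complex.I - v.toNNReal * (1 : ℝ) ^ 2 / 2) =
        Complex.exp (inner ℝ t (0 : Vec d) * Complex.I - v / 2) := by
      congr 1
      simp [hv, variance_nonneg]
    rw [← hlim]
    refine h2.congr fun n => ?_
    have ha := aemeasurable_smul_sum (P := P) hlaw hs n (√n)⁻¹
    rw [charFun_apply, charFun_apply, integral_map (h1.forall_aemeasurable n) (by fun_prop),
      integral_map ha (by fun_prop)]
    congr with ω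
    congr 3
    simp only [hmean, mul_zero, sub_zero]
    rw [inner_smul_left, sum_inner]
    simp [real_inner_comm]

/-- The weak law of large numbers along even sample sizes. -/
theorem tendstoInMeasure_average (hlaw : ∀ i, HasLaw (W i) μ P) (hindep : iIndepFun W P)
    {φ : α → ℝ} (hφ : Measurable φ) (hint : Integrable φ μ) :
    TendstoInMeasure P (fun (n : ℕ) ω => ((2 * n : ℕ) : ℝ)⁻¹ * ∑ i : Fin (2 * n), φ (W i ω)) atTop
      fun _ => ∫ w, φ w ∂μ := by
  have hint0 : Integrable (fun ω => φ (W 0 ω)) P := by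
    rw [← (hlaw 0).map_eq] at hint
    exact hint.comp_aemeasurable (hlaw 0).aemeasurable
  have h := strong_law_ae_real (fun i ω => φ (W i ω)) hint0
    (fun i j hij => (hindep.indepFun hij).comp hφ hφ) (identDistrib_comp hlaw hφ)
  have hmean : ∫ ω, φ (W 0 ω) ∂P = ∫ w, φ w ∂μ := by
    rw [← (hlaw 0).map_eq, integral_map (hlaw 0).aemeasurable hφ.aestronglyMeasurable]
  rw [hmean] at h
  refine tendstoInMeasure_of_tendsto_ae (fun n => ?_) ?_
  · refine (AEMeasurable.const_mul (Finset.aemeasurable_fun_sum _ fun i _ => ?_) _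
      ).aestronglyMeasurable
    exact hφ.comp_aemeasurable (hlaw i).aemeasurable
  · filter_upwards [h] with ω hω
    have h2 : Tendsto (fun n : ℕ => 2 * n) atTop atTop :=
      tendsto_id.const_mul_atTop' (by norm_num)
    refine (hω.comp h2).congr fun n => ?_
    simp only [Function.comp]
    rw [Finset.sum_range fun i => φ (W i ω), div_eq_inv_mul]

end Limit

/-! ### Algebra of the estimators -/

section Algebra

variable {N q d : ℕ}

lemma gramSum_eq (g : Fin 2 → Vec q → Vec d) (lab : Fin N → Fin 2) (w : Fin N → Obs q) :
    gramSum g lab w = ∑ i, outer (g (lab i) (w i).2) :=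
  sum_fold lab fun k i => outer (g k (w i).2)

lemma meatSum_eq (f : Fin 2 → Obs q → ℝ) (g : Fin 2 → Vec q → Vec d) (lab : Fin N → Fin 2)
    (w : Fin N → Obs q) :
    meatSum f g lab w =
      ∑ i, outer (score (f (lab i)) (g (lab i)) (betaHat f g lab w) (w i)) := by
  simp only [score, outer_smul]
  exact sum_fold lab fun k i =>
    resid (f k) (g k) (betaHat f g lab w) (w i) ^ 2 • outer (g k (w i).2)

lemma score_eq_sub (f : Obs q → ℝ) (g : Vec q → Vec d) (β β' : Vec d) (w : Obs q) :
    score f g β' w = score f g β w - inner ℝ (g w.2) (β' - β) • g w.2 := by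
  simp only [score, resid, ← sub_smul, inner_sub_right]
  congr 1
  ring

lemma toEuclideanCLM_eq (M : Matrix (Fin d) (Fin d) ℝ) (x : Vec d) :
    Matrix.toEuclideanCLM (𝕜 := ℝ) M x = WithLp.toLp 2 (M *ᵥ x) := rfl

lemma crossSum_eq (f : Fin 2 → Obs q → ℝ) (g : Fin 2 → Vec q → Vec d) (β : Vec d)
    (lab : Fin N → Fin 2) (w : Fin N → Obs q) :
    crossSum f g lab w = ∑ i, score (f (lab i)) (g (lab i)) β (w i) +
      Matrix.toEuclideanCLM (𝕜 := ℝ) (gramSum g lab w) β := by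
  have h1 : Matrix.toEuclideanCLM (𝕜 := ℝ) (gramSum g lab w) β =
      ∑ i, inner ℝ (g (lab i) (w i).2) β • g (lab i) (w i).2 := by
    rw [gramSum_eq, map_sum, sum_apply]
    refine Finset.sum_congr rfl fun i _ => ?_
    rw [toEuclideanCLM_eq, outer_mulVec]
  rw [h1, crossSum, sum_fold lab fun k i => f k (w i) • g k (w i).2, ← Finset.sum_add_distrib]
  refine Finset.sum_congr rfl fun i _ => ?_
  rw [score, resid, ← add_smul, sub_add_cancel]

/-- The estimation error solves the normal equations with the scores on the right. -/
lemma betaHat_sub_eq (f : Fin 2 → Obs q → ℝ) (g : Fin 2 → Vec q → Vec d) (β : Vec d)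
    (lab : Fin N → Fin 2) (w : Fin N → Obs q) (h : IsUnit (gramSum g lab w).det) :
    betaHat f g lab w - β = Matrix.toEuclideanCLM (𝕜 := ℝ) (gramSum g lab w)⁻¹
      (∑ i, score (f (lab i)) (g (lab i)) β (w i)) := by
  have h1 : betaHat f g lab w =
    Matrix.toEuclideanCLM (𝕜 := ℝ) (gramSum g lab w)⁻¹ (crossSum f g lab w) := rfl
  have h2 : Matrix.toEuclideanCLM (𝕜 := ℝ) (gramSum g lab w)⁻¹
      (Matrix.toEuclideanCLM (𝕜 := ℝ) (gramSum g lab w) β) = β := by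
    rw [← mul_apply_eq_comp, ← map_mul, Matrix.nonsing_inv_mul _ h, map_one]
    rfl
  rw [h1, crossSum_eq f g β, map_add, h2, add_sub_cancel_right]

lemma inv_smul_inv {c : ℝ} (hc : c ≠ 0) (A : Matrix (Fin d) (Fin d) ℝ) :
    (c⁻¹ • A)⁻¹ = c • A⁻¹ := by
  by_cases h : IsUnit A.det
  · refine Matrix.inv_eq_left_inv ?_
    rw [Matrix.smul_mul, Matrix.mul_smul, smul_smul, mul_inv_cancel₀ hc, one_smul,
      Matrix.nonsing_inv_mul _ h]
  · have h' : ¬ IsUnit (c⁻¹ • A).det := by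
      simpa [Matrix.det_smul, isUnit_iff_ne_zero, hc] using h
    rw [Matrix.nonsing_inv_apply_not_isUnit _ h, Matrix.nonsing_inv_apply_not_isUnit _ h',
      smul_zero]

lemma sqrt_smul_betaHat_sub_eq (f : Fin 2 → Obs q → ℝ) (g : Fin 2 → Vec q → Vec d) (β : Vec d)
    (lab : Fin N → Fin 2) (w : Fin N → Obs q) (hN : N ≠ 0) (h : IsUnit (gramSum g lab w).det) :
    √(N : ℝ) • (betaHat f g lab w - β) =
      Matrix.toEuclideanCLM (𝕜 := ℝ) ((N : ℝ)⁻¹ • gramSum g lab w)⁻¹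
        ((√(N : ℝ))⁻¹ • ∑ i, score (f (lab i)) (g (lab i)) β (w i)) := by
  have hN' : (N : ℝ) ≠ 0 := by exact_mod_cast hN
  rw [betaHat_sub_eq f g β lab w h, inv_smul_inv hN', map_smul, map_smul,
    smul_apply, smul_smul]
  congr 1
  rw [eq_inv_mul_iff_mul_eq₀ (Real.sqrt_ne_zero'.2 (by positivity)),
    Real.mul_self_sqrt (by positivity)]

lemma sandwichHat_nonneg (f : Fin 2 → Obs q → ℝ) (g : Fin 2 → Vec q → Vec d)
    (lab : Fin N → Fin 2) (w : Fin N → Obs q) : 0 ≤ sandwichHat f g lab w := by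
  have hG : ((N : ℝ)⁻¹ • gramSum g lab w).PosSemidef := by
    rw [gramSum_eq]
    exact (Matrix.posSemidef_sum _ fun i _ => outer_posSemidef _).smul (by positivity)
  have hM : ((N : ℝ)⁻¹ • meatSum f g lab w).PosSemidef := by
    rw [meatSum_eq]
    exact (Matrix.posSemidef_sum _ fun i _ => outer_posSemidef _).smul (by positivity)
  have h := hM.mul_mul_conjTranspose_same ((N : ℝ)⁻¹ • gramSum g lab w)⁻¹
  rw [hG.isHermitian.inv.eq] at h
  exact h.nonneg

end Algebra

/-! ### Measurability of the estimators -/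

section Measurability

variable {N q d : ℕ}

instance instMeasurableSpaceMatrix : MeasurableSpace (Matrix (Fin d) (Fin d) ℝ) :=
  inferInstanceAs (MeasurableSpace (Fin d → Fin d → ℝ))

instance instBorelSpaceMatrix : BorelSpace (Matrix (Fin d) (Fin d) ℝ) :=
  inferInstanceAs (BorelSpace (Fin d → Fin d → ℝ))

instance instSecondCountableTopologyMatrix :
    SecondCountableTopology (Matrix (Fin d) (Fin d) ℝ) :=
  inferInstanceAs (SecondCountableTopology (Fin d → Fin d → ℝ))

lemma measurable_matrix_inv : Measurable fun A : Matrix (Fin d) (Fin d) ℝ => A⁻¹ := by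
  have h1 : Continuous fun A : Matrix (Fin d) (Fin d) ℝ => A.det := by fun_prop
  have h2 : Continuous fun A : Matrix (Fin d) (Fin d) ℝ => A.adjugate := by fun_prop
  simp_rw [Matrix.inv_def, Ring.inverse_eq_inv']
  exact h1.measurable.inv.smul h2.measurable

lemma continuous_outer : Continuous (outer : Vec d → Matrix (Fin d) (Fin d) ℝ) := by
  refine continuous_matrix fun i j => ?_
  simp only [outer_apply]
  fun_prop

lemma continuous_toEuclideanCLM_apply :
    Continuous fun z : Vec d × Matrix (Fin d) (Fin d) ℝ =>
      Matrix.toEuclideanCLM (𝕜 := ℝ) z.2 z.1 := by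
  simp only [toEuclideanCLM_eq]
  refine (PiLp.continuous_toLp 2 _).comp ?_
  exact Continuous.matrix_mulVec continuous_snd ((PiLp.continuous_ofLp 2 _).comp continuous_fst)

variable {F : Fin 2 → Learner N q (Obs q) ℝ} {G : Fin 2 → Learner N q (Vec q) (Vec d)}

lemma measurable_crossFit_apply {X Y : Type} [MeasurableSpace X] [MeasurableSpace Y]
    {A : Fin 2 → Learner N q X Y} (hA : ∀ k T, Measurable (Function.uncurry (A k T)))
    (ℓ : Fin N → Fin 2) (k : Fin 2) {e : (Fin N → Obs q) → X} (he : Measurable e) :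
    Measurable fun w => crossFit A ℓ w k (e w) :=
  (hA k (fold ℓ k)ᶜ).comp
    (f := fun w : Fin N → Obs q => ((fun i => w i : ↥(fold ℓ k)ᶜ → Obs q), e w)) (by fun_prop)

lemma measurable_gramSum (hG : ∀ k T, Measurable (Function.uncurry (G k T)))
    (ℓ : Fin N → Fin 2) : Measurable fun w => gramSum (crossFit G ℓ w) ℓ w := by
  simp only [gramSum_eq]
  refine Finset.measurable_sum _ fun i _ => continuous_outer.measurable.comp ?_
  exact measurable_crossFit_apply hG ℓ (ℓ i) (by fun_prop)

lemma measurable_scaledGram_inv (hG : ∀ k T, Measurable (Function.uncurry (G k T)))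
    (ℓ : Fin N → Fin 2) :
    Measurable fun w => ((N : ℝ)⁻¹ • gramSum (crossFit G ℓ w) ℓ w)⁻¹ := by
  have h : Measurable fun w => (N : ℝ)⁻¹ • gramSum (crossFit G ℓ w) ℓ w :=
    (measurable_gramSum hG ℓ).const_smul (N : ℝ)⁻¹
  exact measurable_matrix_inv.comp h

lemma measurable_betaHat (hF : ∀ k T, Measurable (Function.uncurry (F k T)))
    (hG : ∀ k T, Measurable (Function.uncurry (G k T))) (ℓ : Fin N → Fin 2) :
    Measurable fun w => betaHat (crossFit F ℓ w) (crossFit G ℓ w) ℓ w := by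
  have hcross : Measurable fun w => crossSum (crossFit F ℓ w) (crossFit G ℓ w) ℓ w := by
    refine Finset.measurable_sum _ fun k _ => Finset.measurable_sum _ fun i _ => ?_
    exact (measurable_crossFit_apply hF ℓ k (by fun_prop)).smul
      (measurable_crossFit_apply hG ℓ k (by fun_prop))
  exact continuous_toEuclideanCLM_apply.measurable.comp
    (hcross.prodMk (measurable_matrix_inv.comp (measurable_gramSum hG ℓ)))

lemma measurable_score (hF : ∀ k T, Measurable (Function.uncurry (F k T)))
    (hG : ∀ k T, Measurable (Function.uncurry (G k T))) (ℓ : Fin N → Fin 2) (k : Fin 2)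
    (i : Fin N) {b : (Fin N → Obs q) → Vec d} (hb : Measurable b) :
    Measurable fun w => score (crossFit F ℓ w k) (crossFit G ℓ w k) (b w) (w i) := by
  have h1 : Measurable fun w : Fin N → Obs q => crossFit F ℓ w k (w i) :=
    measurable_crossFit_apply hF ℓ k (by fun_prop)
  have h2 : Measurable fun w : Fin N → Obs q => crossFit G ℓ w k (w i).2 :=
    measurable_crossFit_apply hG ℓ k (by fun_prop)
  exact (h1.sub (h2.inner hb)).smul h2

lemma measurable_sandwichHat (hF : ∀ k T, Measurable (Function.uncurry (F k T)))
    (hG : ∀ k T, Measurable (Function.uncurry (G k T))) (ℓ : Fin N → Fin 2) :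
    Measurable fun w => sandwichHat (crossFit F ℓ w) (crossFit G ℓ w) ℓ w := by
  have hinv := measurable_scaledGram_inv hG ℓ
  have hmeat : Measurable fun w => (N : ℝ)⁻¹ • meatSum (crossFit F ℓ w) (crossFit G ℓ w) ℓ w := by
    simp only [meatSum_eq]
    have : Measurable fun w => ∑ i, outer (score (crossFit F ℓ w (ℓ i)) (crossFit G ℓ w (ℓ i))
        (betaHat (crossFit F ℓ w) (crossFit G ℓ w) ℓ w) (w i)) :=
      Finset.measurable_sum _ fun i _ => continuous_outer.measurable.comp
        (measurable_score hF hG ℓ (ℓ i) i (measurable_betaHat hF hG ℓ))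
    exact this.const_smul (N : ℝ)⁻¹
  exact (hinv.mul hmeat).mul hinv

lemma measurable_sqrt_inv_comp {α : Type*} [MeasurableSpace α]
    {S : α → Matrix (Fin d) (Fin d) ℝ} (hS : Measurable S) (h0 : ∀ a, 0 ≤ S a) :
    Measurable fun a => (CFC.sqrt (S a))⁻¹ := by
  refine measurable_matrix_inv.comp ?_
  have h := (continuousOn_iff_continuous_domRestrict.1
    (CFC.continuousOn_sqrt (A := Matrix (Fin d) (Fin d) ℝ))).measurable
  exact h.comp (hS.subtype_mk (h := h0))

/-- Measurability of a function of the labels and the data, from measurability in the data. -/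
lemma aemeasurable_of_forall_label {Ω : Type*} [MeasurableSpace Ω] {P : Measure Ω}
    {E : Type*} [MeasurableSpace E] {lab : Ω → Fin N → Fin 2} (hlab : Measurable lab)
    {D : Ω → Fin N → Obs q} (hD : AEMeasurable D P)
    {Ψ : (Fin N → Fin 2) → (Fin N → Obs q) → E} (hΨ : ∀ ℓ, Measurable (Ψ ℓ)) :
    AEMeasurable (fun ω => Ψ (lab ω) (D ω)) P :=
  (measurable_from_prod_countable_right (f := fun z : (Fin N → Fin 2) × (Fin N → Obs q) =>
    Ψ z.1 z.2) hΨ).comp_aemeasurable (hlab.aemeasurable.prodMk hD)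

end Measurability

/-! ### Consistency -/

section Consistency

variable {Ω : Type*} [MeasurableSpace Ω] {P : Measure Ω} {q d : ℕ}

lemma tendstoInMeasure_vec {X : ℕ → Ω → Vec d} {c : Vec d}
    (h : ∀ j, TendstoInMeasure P (fun n ω => X n ω j) atTop fun _ => c j) :
    TendstoInMeasure P X atTop fun _ => c := by
  have h1 : TendstoInMeasure P (fun n ω => WithLp.ofLp (X n ω)) atTop fun _ => WithLp.ofLp c :=
    tendstoInMeasure_pi h
  exact tendstoInMeasure_comp_continuousAt (φ := WithLp.toLp 2) h1
    (PiLp.continuous_toLp 2 _).continuousAt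

lemma tendstoInMeasure_matrix {X : ℕ → Ω → Matrix (Fin d) (Fin d) ℝ}
    {c : Matrix (Fin d) (Fin d) ℝ}
    (h : ∀ i j, TendstoInMeasure P (fun n ω => X n ω i j) atTop fun _ => c i j) :
    TendstoInMeasure P X atTop fun _ => c := by
  let Y : ℕ → Ω → Fin d → Fin d → ℝ := fun n ω i j => X n ω i j
  let c' : Fin d → Fin d → ℝ := fun i j => c i j
  have h1 : TendstoInMeasure P Y atTop fun _ => c' :=
    tendstoInMeasure_pi fun i => tendstoInMeasure_pi fun j => h i j
  let φ : (Fin d → Fin d → ℝ) → Matrix (Fin d) (Fin d) ℝ := fun M => Matrix.of M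
  have hφ : Continuous φ := continuous_matrix fun i j => by
    change Continuous fun M : Fin d → Fin d → ℝ => M i j
    fun_prop
  have h2 := tendstoInMeasure_comp_continuousAt h1 hφ.continuousAt
  exact h2

lemma tendsto_measure_not_mem {E : Type*} [PseudoEMetricSpace E] {X : ℕ → Ω → E} {c : E}
    (hX : TendstoInMeasure P X atTop fun _ => c) {U : Set E} (hU : U ∈ 𝓝 c) :
    Tendsto (fun n => P {ω | X n ω ∉ U}) atTop (𝓝 0) := by
  obtain ⟨ε, hε, h⟩ := EMetric.mem_nhds_iff.1 hU
  refine tendsto_of_tendsto_of_tendsto_of_le_of_le tendsto_const_nhds (hX ε hε)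
    (fun _ => zero_le) fun n => measure_mono fun ω hω => ?_
  by_contra hcon
  exact hω (h (Metric.mem_eball.2 (not_le.1 hcon)))

lemma abs_outer_sub_le (u v : Vec d) (a b : Fin d) :
    |outer u a b - outer v a b| ≤ ‖u - v‖ ^ 2 + 2 * (‖u - v‖ * ‖v‖) := by
  have h (x : Vec d) (j) : |x j| ≤ ‖x‖ := by simpa using PiLp.norm_apply_le x j
  have e : outer u a b - outer v a b =
      (u - v) a * (u - v) b + ((u - v) a * v b + v a * (u - v) b) := by
    simp only [outer_apply, PiLp.sub_apply]
    ring
  have m (x y : Vec d) (i j) : |x i * y j| ≤ ‖x‖ * ‖y‖ := by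
    rw [abs_mul]
    exact mul_le_mul (h x i) (h y j) (abs_nonneg _) (norm_nonneg _)
  rw [e]
  have h1 := m (u - v) (u - v) a b
  have h2 := m (u - v) v a b
  have h3 := m v (u - v) a b
  have h4 := abs_add_le ((u - v) a * (u - v) b) ((u - v) a * v b + v a * (u - v) b)
  have h5 := abs_add_le ((u - v) a * v b) (v a * (u - v) b)
  nlinarith

lemma average_mul_le {ι : Type*} [Fintype ι] (a b : ι → ℝ) {c : ℝ} (hc : 0 ≤ c) :
    c * ∑ i, a i * b i ≤ √(c * ∑ i, a i ^ 2) * √(c * ∑ i, b i ^ 2) := by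
  rw [Real.sqrt_mul hc, Real.sqrt_mul hc]
  have h := mul_le_mul_of_nonneg_left
    (Real.sum_mul_le_sqrt_mul_sqrt Finset.univ a b) hc
  calc _ ≤ _ := h
    _ = (√c * √c) * (√(∑ i, a i ^ 2) * √(∑ i, b i ^ 2)) := by rw [Real.mul_self_sqrt hc]
    _ = _ := by ring

variable [IsProbabilityMeasure P] {μ : Measure (Obs q)} {W : ℕ → Ω → Obs q}

/-- If `u i` is close to `h (W i)` in mean square over the sample, then the average of `u i (u i)ᵀ`
is consistent for the second-moment matrix of `h`. -/
theorem tendstoInMeasure_average_outer (hlaw : ∀ i, HasLaw (W i) μ P) (hindep : iIndepFun W P)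
    {h : Obs q → Vec d} (hh : Measurable h) (hL2 : MemLp h 2 μ)
    {u : ∀ n : ℕ, Ω → Fin (2 * n) → Vec d}
    (hu : TendstoInMeasure P (fun n ω =>
      ((2 * n : ℕ) : ℝ)⁻¹ * ∑ i : Fin (2 * n), ‖u n ω i - h (W i ω)‖ ^ 2) atTop fun _ => 0) :
    TendstoInMeasure P (fun n ω => ((2 * n : ℕ) : ℝ)⁻¹ • ∑ i, outer (u n ω i)) atTop
      fun _ => secondMoment μ h := by
  refine tendstoInMeasure_matrix fun a b => ?_
  have hL : TendstoInMeasure P (fun (n : ℕ) ω =>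
      ((2 * n : ℕ) : ℝ)⁻¹ * ∑ i : Fin (2 * n), outer (h (W i ω)) a b) atTop
      fun _ => secondMoment μ h a b :=
    tendstoInMeasure_average hlaw hindep (φ := fun w => outer (h w) a b)
      ((continuous_outer.matrix_elem a b).measurable.comp hh) (integrable_outer hL2 a b)
  have hS := tendstoInMeasure_average hlaw hindep (φ := fun w => ‖h w‖ ^ 2) (by fun_prop)
    (hL2.integrable_norm_pow two_ne_zero)
  have hbound := tendstoInMeasure_comp_continuousAt (tendstoInMeasure_prodMk hu hS)
    (φ := fun z : ℝ × ℝ => z.1 + 2 * (√z.1 * √z.2)) (by fun_prop)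
  simp only [Real.sqrt_zero, zero_mul, mul_zero, add_zero] at hbound
  have hdiff : TendstoInMeasure P (fun (n : ℕ) ω => ((2 * n : ℕ) : ℝ)⁻¹ *
      ∑ i : Fin (2 * n), (outer (u n ω i) a b - outer (h (W i ω)) a b)) atTop
      fun _ => (0 : ℝ) := by
    refine tendstoInMeasure_of_le_off (B := fun _ => ∅) hbound (by simp)
      (Eventually.of_forall fun n ω _ => ?_)
    rw [edist_zero_right, ← ofReal_norm, Real.norm_eq_abs, abs_mul, abs_of_nonneg (by positivity)]
    refine ENNReal.ofReal_le_ofReal ?_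
    have hc : (0 : ℝ) ≤ ((2 * n : ℕ) : ℝ)⁻¹ := by positivity
    refine le_trans (mul_le_mul_of_nonneg_left ((Finset.abs_sum_le_sum_abs _ _).trans
      (Finset.sum_le_sum fun i _ => abs_outer_sub_le (u n ω i) (h (W i ω)) a b)) hc) ?_
    rw [Finset.sum_add_distrib, mul_add, ← Finset.mul_sum, mul_left_comm]
    have := average_mul_le (fun i => ‖u n ω i - h (W i ω)‖) (fun i : Fin (2 * n) => ‖h (W i ω)‖) hc
    linarith
  have hsum := tendstoInMeasure_comp_continuousAt (tendstoInMeasure_prodMk hL hdiff)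
    (φ := fun z : ℝ × ℝ => z.1 + z.2) (by fun_prop)
  simp only [add_zero] at hsum
  refine hsum.congr_left fun n => Eventually.of_forall fun ω => ?_
  simp only [Matrix.smul_apply, Matrix.sum_apply, smul_eq_mul]
  rw [← mul_add, ← Finset.sum_add_distrib]
  simp

variable [IsProbabilityMeasure μ] {lab : ∀ n : ℕ, Ω → Fin (2 * n) → Fin 2}

/-- Vector form of `crossFitSum_tendsto_zero`. -/
theorem crossFitVecSum_tendsto_zero (hlaw : ∀ i, HasLaw (W i) μ P) (hindep : iIndepFun W P)
    (hlab : ∀ n, Measurable (lab n)) (hcard : ∀ n ω k, (fold (lab n ω) k).card = n)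
    (hlab_indep : ∀ n, IndepFun (lab n) (fun ω (i : Fin (2 * n)) => W i ω) P)
    {A : ∀ n, Fin 2 → Learner (2 * n) q (Obs q) (Vec d)}
    (hA : ∀ n k T, Measurable (Function.uncurry (A n k T)))
    (hvan : ∀ k, VanishesInProbability P fun n ω =>
      ∫⁻ w, ‖crossFit (A n) (lab n ω) (fun i => W i ω) k w‖ₑ ^ 2 ∂μ)
    (hmean : ∀ k, TendstoInMeasure P (fun n ω => √((2 * n : ℕ) : ℝ) *
      ‖∫ w, crossFit (A n) (lab n ω) (fun i => W i ω) k w ∂μ‖) atTop fun _ => 0) :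
    TendstoInMeasure P (fun n ω => (√((2 * n : ℕ) : ℝ))⁻¹ •
      ∑ i : Fin (2 * n), crossFit (A n) (lab n ω) (fun i => W i ω) (lab n ω i) (W i ω))
      atTop fun _ => 0 := by
  refine tendstoInMeasure_vec fun j => ?_
  have hnorm (x : Vec d) : ‖x j‖ₑ ≤ ‖x‖ₑ := by
    rw [← ofReal_norm, ← ofReal_norm]
    exact ENNReal.ofReal_le_ofReal (PiLp.norm_apply_le x j)
  have key := crossFitSum_tendsto_zero hlaw hindep hlab hcard hlab_indep
    (A := fun n k T x w => A n k T x w j)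
    (fun n k T => (by fun_prop : Measurable fun x : Vec d => x j).comp (hA n k T))
    (fun k => (hvan k).mono fun n ω => lintegral_mono fun w => pow_le_pow_left' (hnorm _) 2)
    (fun k => ?_)
  · refine key.congr_left fun n => Eventually.of_forall fun ω => ?_
    simp only [PiLp.smul_apply, smul_eq_mul, WithLp.ofLp_sum, Finset.sum_apply]
    rfl
  · refine tendstoInMeasure_of_le_off (hmean k) (hvan k 1 one_pos)
      (Eventually.of_forall fun n ω hω => ?_)
    set c := crossFit (A n) (lab n ω) (fun i => W i ω) k with hc
    have hcm : Measurable c := (hA n k _).comp measurable_prodMk_left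
    have hint : Integrable c μ := by
      have h2 : MemLp c 2 μ := by
        refine ⟨hcm.aestronglyMeasurable, ?_⟩
        rw [eLpNorm_lt_top_iff_lintegral_rpow_enorm_lt_top two_ne_zero ENNReal.ofNat_ne_top]
        have : ∫⁻ w, ‖c w‖ₑ ^ 2 ∂μ < 1 := not_le.1 hω
        simpa using this.trans ENNReal.one_lt_top
      exact h2.integrable one_le_two
    have hcoord : ∫ w, c w j ∂μ = (∫ w, c w ∂μ) j :=
      ((EuclideanSpace.proj (𝕜 := ℝ) j).integral_comp_comm hint)
    have hgoal : edist (√((2 * n : ℕ) : ℝ) * ∫ w, c w j ∂μ) 0 ≤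
        ENNReal.ofReal (√((2 * n : ℕ) : ℝ) * ‖∫ w, c w ∂μ‖) := by
      rw [hcoord, edist_zero_right, ← ofReal_norm, norm_mul,
        Real.norm_of_nonneg (Real.sqrt_nonneg _)]
      gcongr
      exact PiLp.norm_apply_le _ j
    exact hgoal

end Consistency

lemma lintegral_enorm_pow {α E : Type*} [MeasurableSpace α] {μ : Measure α} [NormedAddCommGroup E]
    (f : α → E) {p : ℕ} (hp : p ≠ 0) : ∫⁻ w, ‖f w‖ₑ ^ p ∂μ = eLpNorm f p μ ^ p := by
  have h := eLpNorm_nnreal_pow_eq_lintegral (f := f) (μ := μ) (p := (p : ℝ≥0)) (by simpa using hp)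
  simpa using h.symm

/-! ### Asymptotics of the estimators -/

section Asymptotics

lemma popMeat_eq {q d : ℕ} (μ : Measure (Obs q)) (fs : Obs q → ℝ) (gs : Vec q → Vec d)
    (β : Vec d) : popMeat μ fs gs β = secondMoment μ (score fs gs β) := by
  ext i j
  simp only [popMeat, secondMoment, Matrix.of_apply, score, outer_smul, Matrix.smul_apply,
    smul_eq_mul]

variable {Ω : Type*} [MeasurableSpace Ω] {P : Measure Ω} {q d : ℕ}

/-- An i.i.d. sample, random splits into two halves independent of it, and measurable estimation
procedures. -/
structure CrossFitting (P : Measure Ω) (W : ℕ → Ω → Obs q) (μ : Measure (Obs q))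
    (lab : ∀ n : ℕ, Ω → Fin (2 * n) → Fin 2)
    (F : ∀ n : ℕ, Fin 2 → Learner (2 * n) q (Obs q) ℝ)
    (G : ∀ n : ℕ, Fin 2 → Learner (2 * n) q (Vec q) (Vec d)) : Prop where
  law : ∀ i, HasLaw (W i) μ P
  indep : iIndepFun W P
  measurable_lab : ∀ n, Measurable (lab n)
  card_fold : ∀ n ω k, (fold (lab n ω) k).card = n
  indep_lab : ∀ n, IndepFun (lab n) (fun ω (i : Fin (2 * n)) => W i ω) P
  measurable_F : ∀ n k T, Measurable (Function.uncurry (F n k T))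
  measurable_G : ∀ n k T, Measurable (Function.uncurry (G n k T))

/-- The first `2 n` observations. -/
abbrev sample (W : ℕ → Ω → Obs q) (n : ℕ) (ω : Ω) : Fin (2 * n) → Obs q := fun i => W i ω

/-- The cross-fitted functions computed from the first `2 n` observations. -/
abbrev fit {X Y : Type} (A : ∀ n : ℕ, Fin 2 → Learner (2 * n) q X Y)
    (lab : ∀ n : ℕ, Ω → Fin (2 * n) → Fin 2) (W : ℕ → Ω → Obs q) (n : ℕ) (ω : Ω) :
    Fin 2 → X → Y :=
  crossFit (A n) (lab n ω) (sample W n ω)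

/-- The cross-fitted scores at the observations. -/
noncomputable abbrev scoreHat (F : ∀ n : ℕ, Fin 2 → Learner (2 * n) q (Obs q) ℝ)
    (G : ∀ n : ℕ, Fin 2 → Learner (2 * n) q (Vec q) (Vec d))
    (lab : ∀ n : ℕ, Ω → Fin (2 * n) → Fin 2) (W : ℕ → Ω → Obs q) (β : Vec d) (n : ℕ) (ω : Ω)
    (i : Fin (2 * n)) : Vec d :=
  score (fit F lab W n ω (lab n ω i)) (fit G lab W n ω (lab n ω i)) β (W i ω)

/-- Consistent estimation of the normal equations, which hold for `fs`, `gs` and `β`. -/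
structure ConsistentScore (P : Measure Ω) (W : ℕ → Ω → Obs q) (μ : Measure (Obs q))
    (lab : ∀ n : ℕ, Ω → Fin (2 * n) → Fin 2)
    (F : ∀ n : ℕ, Fin 2 → Learner (2 * n) q (Obs q) ℝ)
    (G : ∀ n : ℕ, Fin 2 → Learner (2 * n) q (Vec q) (Vec d))
    (fs : Obs q → ℝ) (gs : Vec q → Vec d) (β : Vec d) : Prop where
  measurable_fs : Measurable fs
  measurable_gs : Measurable gs
  memLp : MemLp (score fs gs β) 2 μ
  integral_eq_zero : ∫ w, score fs gs β w ∂μ = 0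
  mean : ∀ k, TendstoInMeasure P (fun n ω => √((2 * n : ℕ) : ℝ) *
    ‖∫ w, score (fit F lab W n ω k) (fit G lab W n ω k) β w ∂μ‖) atTop fun _ => 0
  norm : ∀ k, VanishesInProbability P fun n ω =>
    eLpNorm (fun w => score (fit F lab W n ω k) (fit G lab W n ω k) β w - score fs gs β w) 2 μ

variable {μ : Measure (Obs q)} {W : ℕ → Ω → Obs q} {lab : ∀ n : ℕ, Ω → Fin (2 * n) → Fin 2}
  {F : ∀ n : ℕ, Fin 2 → Learner (2 * n) q (Obs q) ℝ}
  {G : ∀ n : ℕ, Fin 2 → Learner (2 * n) q (Vec q) (Vec d)}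
  {fs : Obs q → ℝ} {gs : Vec q → Vec d} {β : Vec d}

lemma measurable_score_fun {f : Obs q → ℝ} {g : Vec q → Vec d} (hf : Measurable f)
    (hg : Measurable g) (β : Vec d) : Measurable (score f g β) := by
  unfold score resid
  fun_prop

lemma measurable_scoreLearner {X : Type*} [MeasurableSpace X] {f : X → Obs q → ℝ}
    {g : X → Vec q → Vec d} (hf : Measurable (Function.uncurry f))
    (hg : Measurable (Function.uncurry g)) (β : Vec d) :
    Measurable (Function.uncurry fun x => score (f x) (g x) β) := by
  have h2 : Measurable fun z : X × Obs q => g z.1 z.2.2 :=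
    hg.comp (f := fun z : X × Obs q => (z.1, z.2.2)) (by fun_prop)
  exact (hf.sub (h2.inner measurable_const)).smul h2

lemma ConsistentScore.measurable_score (C : ConsistentScore P W μ lab F G fs gs β) :
    Measurable (score fs gs β) :=
  measurable_score_fun C.measurable_fs C.measurable_gs β

lemma ConsistentScore.vanishes (C : ConsistentScore P W μ lab F G fs gs β) (k : Fin 2) :
    VanishesInProbability P fun n ω =>
      ∫⁻ w, ‖score (fit F lab W n ω k) (fit G lab W n ω k) β w - score fs gs β w‖ₑ ^ 2 ∂μ := by
  simp only [lintegral_enorm_pow _ two_ne_zero]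
  exact (C.norm k).pow two_ne_zero

namespace CrossFitting

lemma aemeasurable_sample (S : CrossFitting P W μ lab F G) (n : ℕ) :
    AEMeasurable (sample W n) P :=
  aemeasurable_pi_lambda _ fun i => (S.law i).aemeasurable

lemma measurable_scoreDiff (S : CrossFitting P W μ lab F G)
    (C : ConsistentScore P W μ lab F G fs gs β) (n : ℕ) (k : Fin 2) (T : Finset (Fin (2 * n))) :
    Measurable (Function.uncurry fun (x : T → Obs q) w =>
      score (F n k T x) (G n k T x) β w - score fs gs β w) :=
  (measurable_scoreLearner (S.measurable_F n k T) (S.measurable_G n k T) β).sub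
    (C.measurable_score.comp measurable_snd)

variable [IsProbabilityMeasure P] [IsProbabilityMeasure μ]

/-- Consistency of the normalized Gram matrix. -/
theorem gram_tendsto (S : CrossFitting P W μ lab F G) (hgs : Measurable gs)
    (hV : MemLp (fun w : Obs q => gs w.2) 2 μ)
    (hc : ∀ k, VanishesInProbability P fun n ω =>
      eLpNorm (fun w : Obs q => fit G lab W n ω k w.2 - gs w.2) 2 μ) :
    TendstoInMeasure P (fun n ω =>
      ((2 * n : ℕ) : ℝ)⁻¹ • gramSum (fit G lab W n ω) (lab n ω) (sample W n ω)) atTop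
      fun _ => popGram μ gs := by
  simp only [gramSum_eq]
  refine tendstoInMeasure_average_outer S.law S.indep (h := fun w => gs w.2) (by fun_prop) hV ?_
  refine crossFitAverage_tendsto_zero S.law S.indep S.measurable_lab S.card_fold S.indep_lab
    (A := fun n k T x w => G n k T x w.2 - gs w.2) (fun n k T => ?_) 2 fun k => ?_
  · exact ((S.measurable_G n k T).comp (f := fun z : (T → Obs q) × Obs q => (z.1, z.2.2))
      (by fun_prop)).sub (by fun_prop)
  · simp only [lintegral_enorm_pow _ two_ne_zero]
    exact (hc k).pow two_ne_zero

/-- The estimated scores are close to the true ones in mean square over the sample. -/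
theorem average_scoreDiff_tendsto (S : CrossFitting P W μ lab F G)
    (C : ConsistentScore P W μ lab F G fs gs β) :
    TendstoInMeasure P (fun n ω => ((2 * n : ℕ) : ℝ)⁻¹ *
      ∑ i, ‖scoreHat F G lab W β n ω i - score fs gs β (W i ω)‖ ^ 2) atTop fun _ => 0 :=
  crossFitAverage_tendsto_zero S.law S.indep S.measurable_lab S.card_fold S.indep_lab
    (A := fun n k T x w => score (F n k T x) (G n k T x) β w - score fs gs β w)
    (S.measurable_scoreDiff C) 2 C.vanishes

theorem sum_scoreDiff_tendsto (S : CrossFitting P W μ lab F G)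
    (C : ConsistentScore P W μ lab F G fs gs β) :
    TendstoInMeasure P (fun n ω => (√((2 * n : ℕ) : ℝ))⁻¹ •
      ∑ i, (scoreHat F G lab W β n ω i - score fs gs β (W i ω))) atTop fun _ => 0 := by
  refine crossFitVecSum_tendsto_zero S.law S.indep S.measurable_lab S.card_fold S.indep_lab
    (A := fun n k T x w => score (F n k T x) (G n k T x) β w - score fs gs β w)
    (S.measurable_scoreDiff C) C.vanishes fun k => ?_
  refine (C.mean k).congr_left fun n => Eventually.of_forall fun ω => ?_
  have hint : Integrable (score fs gs β) μ := C.memLp.integrable one_le_two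
  have : ∫ w, (score (fit F lab W n ω k) (fit G lab W n ω k) β w - score fs gs β w) ∂μ =
      ∫ w, score (fit F lab W n ω k) (fit G lab W n ω k) β w ∂μ := by
    by_cases hi : Integrable (score (fit F lab W n ω k) (fit G lab W n ω k) β) μ
    · rw [integral_sub hi hint, C.integral_eq_zero, sub_zero]
    · rw [integral_undef hi, integral_undef]
      intro hi'
      exact hi ((hi'.add hint).congr (Eventually.of_forall fun w => by simp))
  exact congrArg (fun x => √((2 * n : ℕ) : ℝ) * ‖x‖) this.symm

/-- Asymptotic normality of the normalized sum of the estimated scores. -/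
theorem sum_score_tendstoInDistribution (S : CrossFitting P W μ lab F G)
    (C : ConsistentScore P W μ lab F G fs gs β) :
    TendstoInDistribution (fun n ω => (√((2 * n : ℕ) : ℝ))⁻¹ • ∑ i, scoreHat F G lab W β n ω i)
      atTop id (fun _ => P) (multivariateGaussian 0 (popMeat μ fs gs β)) := by
  rw [popMeat_eq]
  have hclt := tendstoInDistribution_inv_sqrt_smul_sum S.law S.indep
    C.measurable_score C.memLp C.integral_eq_zero
  have h2 : Tendsto (fun n : ℕ => 2 * n) atTop atTop := tendsto_id.const_mul_atTop' (by norm_num)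
  have hclt2 : TendstoInDistribution (fun (n : ℕ) ω => (√((2 * n : ℕ) : ℝ))⁻¹ •
      ∑ i ∈ Finset.range (2 * n), score fs gs β (W i ω)) atTop id (fun _ => P)
      (multivariateGaussian 0 (secondMoment μ (score fs gs β))) :=
    ⟨fun n => hclt.forall_aemeasurable (2 * n), aemeasurable_id, hclt.tendsto.comp h2⟩
  refine tendstoInDistribution_of_tendstoInMeasure_sub _ _ hclt2 ?_ fun n => ?_
  · refine (S.sum_scoreDiff_tendsto C).congr_left fun n =>
      Eventually.of_forall fun ω => ?_
    simp only [Pi.sub_apply]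
    rw [Finset.sum_range fun i => score fs gs β (W i ω), ← smul_sub, Finset.sum_sub_distrib]
  · refine aemeasurable_of_forall_label (S.measurable_lab n) (S.aemeasurable_sample n)
      (Ψ := fun ℓ w => (√((2 * n : ℕ) : ℝ))⁻¹ • ∑ i, score (crossFit (F n) ℓ w (ℓ i))
        (crossFit (G n) ℓ w (ℓ i)) β (w i)) fun ℓ => ?_
    have h : Measurable fun w : Fin (2 * n) → Obs q => ∑ i, score (crossFit (F n) ℓ w (ℓ i))
        (crossFit (G n) ℓ w (ℓ i)) β (w i) :=
      Finset.measurable_sum _ fun i _ =>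
        measurable_score (S.measurable_F n) (S.measurable_G n) ℓ (ℓ i) i measurable_const
    exact h.const_smul (√((2 * n : ℕ) : ℝ))⁻¹

/-- The average of the estimated scores vanishes in probability. -/
theorem average_score_tendsto_zero (S : CrossFitting P W μ lab F G)
    (C : ConsistentScore P W μ lab F G fs gs β) :
    TendstoInMeasure P (fun n ω => ((2 * n : ℕ) : ℝ)⁻¹ • ∑ i, scoreHat F G lab W β n ω i)
      atTop fun _ => 0 := by
  have hlln : TendstoInMeasure P (fun (n : ℕ) ω => ((2 * n : ℕ) : ℝ)⁻¹ •
      ∑ i : Fin (2 * n), score fs gs β (W i ω)) atTop fun _ => 0 := by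
    refine tendstoInMeasure_vec fun j => ?_
    have hint : Integrable (score fs gs β) μ := C.memLp.integrable one_le_two
    have hj : Measurable fun w => score fs gs β w j :=
      (by fun_prop : Measurable fun x : Vec d => x j).comp C.measurable_score
    have hij : Integrable (fun w => score fs gs β w j) μ :=
      (C.memLp.eval_piLp j).integrable one_le_two
    have h := tendstoInMeasure_average S.law S.indep hj hij
    have hz : ∫ w, score fs gs β w j ∂μ = 0 :=
      ((EuclideanSpace.proj (𝕜 := ℝ) j).integral_comp_comm hint).trans
        (by rw [C.integral_eq_zero, map_zero])
    rw [hz] at h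
    refine h.congr_left fun n => Eventually.of_forall fun ω => ?_
    simp
  have hdiff : TendstoInMeasure P (fun n ω => ((2 * n : ℕ) : ℝ)⁻¹ •
      ∑ i, (scoreHat F G lab W β n ω i - score fs gs β (W i ω))) atTop fun _ => 0 := by
    have h := tendstoInMeasure_comp_continuousAt
      (S.sum_scoreDiff_tendsto C) (φ := fun x => ‖x‖) (by fun_prop)
    rw [norm_zero] at h
    refine tendstoInMeasure_of_le_off (B := fun _ => ∅) h (by simp) ?_
    filter_upwards [eventually_ge_atTop 1] with n hn ω _
    rw [edist_zero_right, ← ofReal_norm]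
    refine ENNReal.ofReal_le_ofReal ?_
    rw [norm_smul, norm_smul]
    refine mul_le_mul_of_nonneg_right ?_ (norm_nonneg _)
    have hN : (1 : ℝ) ≤ ((2 * n : ℕ) : ℝ) := by exact_mod_cast (by omega : 1 ≤ 2 * n)
    rw [norm_inv, norm_inv, Real.norm_of_nonneg (Real.sqrt_nonneg _),
      Real.norm_of_nonneg (by positivity)]
    exact inv_anti₀ (Real.sqrt_pos.2 (by positivity))
      (Real.sqrt_le_iff.2 ⟨by positivity, by nlinarith⟩)
  have hsum := tendstoInMeasure_comp_continuousAt (tendstoInMeasure_prodMk hlln hdiff)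
    (φ := fun z : Vec d × Vec d => z.1 + z.2) (by fun_prop)
  simp only [add_zero] at hsum
  refine hsum.congr_left fun n => Eventually.of_forall fun ω => ?_
  simp only
  rw [← smul_add, ← Finset.sum_add_distrib]
  simp

end CrossFitting

end Asymptotics

namespace CrossFitting

variable {Ω : Type*} [MeasurableSpace Ω] {P : Measure Ω} {q d : ℕ} {μ : Measure (Obs q)}
  {W : ℕ → Ω → Obs q} {lab : ∀ n : ℕ, Ω → Fin (2 * n) → Fin 2}
  {F : ∀ n : ℕ, Fin 2 → Learner (2 * n) q (Obs q) ℝ}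
  {G : ∀ n : ℕ, Fin 2 → Learner (2 * n) q (Vec q) (Vec d)}
  {fs : Obs q → ℝ} {gs : Vec q → Vec d} {β : Vec d}

lemma tendsto_measure_singular
    (hΓ : TendstoInMeasure P (fun n ω =>
      ((2 * n : ℕ) : ℝ)⁻¹ • gramSum (fit G lab W n ω) (lab n ω) (sample W n ω)) atTop
      fun _ => popGram μ gs) (hA : IsUnit (popGram μ gs).det) :
    Tendsto (fun n => P {ω | ¬ IsUnit (gramSum (fit G lab W n ω) (lab n ω) (sample W n ω)).det})
      atTop (𝓝 0) := by
  have hU : {M : Matrix (Fin d) (Fin d) ℝ | M.det ≠ 0} ∈ 𝓝 (popGram μ gs) :=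
    (isOpen_ne_fun (by fun_prop) continuous_const).mem_nhds hA.ne_zero
  refine tendsto_of_tendsto_of_tendsto_of_le_of_le tendsto_const_nhds
    (tendsto_measure_not_mem hΓ hU) (fun _ => zero_le) fun n => measure_mono fun ω hω => ?_
  have hdet : (gramSum (fit G lab W n ω) (lab n ω) (sample W n ω)).det = 0 := by
    simpa [isUnit_iff_ne_zero] using hω
  have hmem : (((2 * n : ℕ) : ℝ)⁻¹ •
      gramSum (fit G lab W n ω) (lab n ω) (sample W n ω)).det = 0 := by
    rw [Matrix.det_smul, hdet, mul_zero]
  exact fun hne => hne hmem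

lemma popGram_posSemidef (hV : MemLp (fun w : Obs q => gs w.2) 2 μ) :
    (popGram μ gs).PosSemidef :=
  secondMoment_posSemidef hV

lemma popMeat_posSemidef (C : ConsistentScore P W μ lab F G fs gs β) :
    (popMeat μ fs gs β).PosSemidef := by
  rw [popMeat_eq]
  exact secondMoment_posSemidef C.memLp

lemma popGram_inv_transpose (hV : MemLp (fun w : Obs q => gs w.2) 2 μ) :
    ((popGram μ gs)⁻¹)ᵀ = (popGram μ gs)⁻¹ := by
  rw [← Matrix.conjTranspose_eq_transpose_of_trivial]
  exact (popGram_posSemidef hV).isHermitian.inv.eq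

lemma popSandwich_posSemidef (C : ConsistentScore P W μ lab F G fs gs β)
    (hV : MemLp (fun w : Obs q => gs w.2) 2 μ) : (popSandwich μ fs gs β).PosSemidef := by
  have h := (popMeat_posSemidef C).mul_mul_conjTranspose_same (popGram μ gs)⁻¹
  rwa [(popGram_posSemidef hV).isHermitian.inv.eq] at h

lemma aemeasurable_betaHat (S : CrossFitting P W μ lab F G) (n : ℕ) :
    AEMeasurable (fun ω => betaHat (fit F lab W n ω) (fit G lab W n ω) (lab n ω) (sample W n ω))
      P :=
  aemeasurable_of_forall_label (S.measurable_lab n) (S.aemeasurable_sample n)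
    fun ℓ => measurable_betaHat (S.measurable_F n) (S.measurable_G n) ℓ

lemma aemeasurable_sqrt_smul_betaHat_sub (S : CrossFitting P W μ lab F G) (β : Vec d) (n : ℕ) :
    AEMeasurable (fun ω => √((2 * n : ℕ) : ℝ) •
      (betaHat (fit F lab W n ω) (fit G lab W n ω) (lab n ω) (sample W n ω) - β)) P := by
  have h : AEMeasurable (fun ω =>
      betaHat (fit F lab W n ω) (fit G lab W n ω) (lab n ω) (sample W n ω) - β) P :=
    (S.aemeasurable_betaHat n).sub_const β
  exact h.const_smul (√((2 * n : ℕ) : ℝ))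

/-- Consistency of the plug-in covariance. -/
theorem sandwichHat_tendsto
    (hΓ : TendstoInMeasure P (fun n ω =>
      ((2 * n : ℕ) : ℝ)⁻¹ • gramSum (fit G lab W n ω) (lab n ω) (sample W n ω)) atTop
      fun _ => popGram μ gs) (hA : IsUnit (popGram μ gs).det)
    (hM : TendstoInMeasure P (fun n ω => ((2 * n : ℕ) : ℝ)⁻¹ •
      meatSum (fit F lab W n ω) (fit G lab W n ω) (lab n ω) (sample W n ω)) atTop
      fun _ => popMeat μ fs gs β) :
    TendstoInMeasure P (fun n ω =>
      sandwichHat (fit F lab W n ω) (fit G lab W n ω) (lab n ω) (sample W n ω)) atTop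
      fun _ => popSandwich μ fs gs β := by
  have hcont : Continuous fun z : Matrix (Fin d) (Fin d) ℝ × Matrix (Fin d) (Fin d) ℝ =>
      z.1 * z.2 * z.1 :=
    (continuous_fst.mul continuous_snd).mul continuous_fst
  have hpair := tendstoInMeasure_prodMk
    (tendstoInMeasure_comp_continuousAt hΓ (continuousAt_matrix_inv hA)) hM
  have h := tendstoInMeasure_comp_continuousAt hpair hcont.continuousAt
  exact h

variable [IsProbabilityMeasure P]

/-- The Gram matrix is invertible with probability tending to one. -/
theorem tendsto_measure_isUnit_det
    (hΓ : TendstoInMeasure P (fun n ω =>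
      ((2 * n : ℕ) : ℝ)⁻¹ • gramSum (fit G lab W n ω) (lab n ω) (sample W n ω)) atTop
      fun _ => popGram μ gs) (hA : IsUnit (popGram μ gs).det) :
    Tendsto (fun n => P {ω | IsUnit (gramSum (fit G lab W n ω) (lab n ω) (sample W n ω)).det})
      atTop (𝓝 1) := by
  have h := ENNReal.Tendsto.sub (tendsto_const_nhds (x := (1 : ℝ≥0∞)))
    (tendsto_measure_singular hΓ hA) (Or.inl ENNReal.one_ne_top)
  rw [tsub_zero] at h
  refine tendsto_of_tendsto_of_tendsto_of_le_of_le h tendsto_const_nhds (fun n => ?_)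
    fun n => prob_le_one
  refine tsub_le_iff_right.2 ?_
  rw [← measure_univ (μ := P)]
  refine (measure_mono fun ω _ => ?_).trans (measure_union_le _ _)
  exact em _

/-- Asymptotic normality of the studentized estimator. -/
theorem studentized_tendstoInDistribution (S : CrossFitting P W μ lab F G)
    (hpos : (popSandwich μ fs gs β).PosSemidef)
    (hunit : IsUnit (popSandwich μ fs gs β).det)
    (hcov : TendstoInMeasure P (fun n ω =>
      sandwichHat (fit F lab W n ω) (fit G lab W n ω) (lab n ω) (sample W n ω)) atTop
      fun _ => popSandwich μ fs gs β)
    (hdist : TendstoInDistribution (fun n ω => √((2 * n : ℕ) : ℝ) •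
        (betaHat (fit F lab W n ω) (fit G lab W n ω) (lab n ω) (sample W n ω) - β))
      atTop id (fun _ => P) (multivariateGaussian 0 (popSandwich μ fs gs β))) :
    TendstoInDistribution (fun n ω => √((2 * n : ℕ) : ℝ) • Matrix.toEuclideanCLM (𝕜 := ℝ)
          (CFC.sqrt (sandwichHat (fit F lab W n ω) (fit G lab W n ω) (lab n ω) (sample W n ω)))⁻¹
          (betaHat (fit F lab W n ω) (fit G lab W n ω) (lab n ω) (sample W n ω) - β))
      atTop id (fun _ => P) (multivariateGaussian 0 (1 : Matrix (Fin d) (Fin d) ℝ)) := by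
  set A := popSandwich μ fs gs β
  set R := CFC.sqrt A with hR
  have hRR : R * R = A := CFC.sqrt_mul_sqrt_self A hpos.nonneg
  have hRunit : IsUnit R.det := by
    rw [← hRR, Matrix.det_mul] at hunit
    exact isUnit_of_mul_isUnit_left hunit
  have hRsymm : (R⁻¹)ᵀ = R⁻¹ := by
    rw [← Matrix.conjTranspose_eq_transpose_of_trivial]
    exact (Matrix.nonneg_iff_posSemidef.1 (CFC.sqrt_nonneg A)).isHermitian.inv.eq
  have hcont : ContinuousWithinAt (fun B : Matrix (Fin d) (Fin d) ℝ => (CFC.sqrt B)⁻¹)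
      {B | 0 ≤ B} A :=
    (continuousAt_matrix_inv hRunit).comp_continuousWithinAt
      (CFC.continuousOn_sqrt (A := Matrix (Fin d) (Fin d) ℝ) A hpos.nonneg)
  have hY := tendstoInMeasure_comp_continuousWithinAt hcov
    (fun n ω => sandwichHat_nonneg _ _ _ _) hcont
  have hslutsky := hdist.continuous_comp_prodMk_of_tendstoInMeasure_const
    continuous_toEuclideanCLM_apply hY fun n =>
      aemeasurable_of_forall_label (S.measurable_lab n) (S.aemeasurable_sample n)
        fun ℓ => measurable_sqrt_inv_comp
          (measurable_sandwichHat (S.measurable_F n) (S.measurable_G n) ℓ)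
          fun w => sandwichHat_nonneg _ _ _ _
  have hmap := map_toEuclideanCLM_multivariateGaussian hpos R⁻¹
  have hone : R⁻¹ * A * R⁻¹ = 1 := by
    rw [← hRR, ← Matrix.mul_assoc, Matrix.nonsing_inv_mul _ hRunit, Matrix.one_mul,
      Matrix.mul_nonsing_inv _ hRunit]
  rw [hRsymm, hone] at hmap
  have h := TendstoInDistribution.id_of_map_eq hslutsky hmap
  simpa only [map_smul] using h

variable [IsProbabilityMeasure μ]

/-- Asymptotic normality of the estimator. -/
theorem betaHat_tendstoInDistribution (S : CrossFitting P W μ lab F G)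
    (C : ConsistentScore P W μ lab F G fs gs β) (hV : MemLp (fun w : Obs q => gs w.2) 2 μ)
    (hΓ : TendstoInMeasure P (fun n ω =>
      ((2 * n : ℕ) : ℝ)⁻¹ • gramSum (fit G lab W n ω) (lab n ω) (sample W n ω)) atTop
      fun _ => popGram μ gs) (hA : IsUnit (popGram μ gs).det) :
    TendstoInDistribution (fun n ω => √((2 * n : ℕ) : ℝ) •
        (betaHat (fit F lab W n ω) (fit G lab W n ω) (lab n ω) (sample W n ω) - β))
      atTop id (fun _ => P) (multivariateGaussian 0 (popSandwich μ fs gs β)) := by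
  have hslutsky := (S.sum_score_tendstoInDistribution C
    ).continuous_comp_prodMk_of_tendstoInMeasure_const continuous_toEuclideanCLM_apply
    (tendstoInMeasure_comp_continuousAt hΓ (continuousAt_matrix_inv hA)) fun n =>
      aemeasurable_of_forall_label (S.measurable_lab n) (S.aemeasurable_sample n)
        fun ℓ => measurable_scaledGram_inv (S.measurable_G n) ℓ
  have hmap := map_toEuclideanCLM_multivariateGaussian (popMeat_posSemidef C) (popGram μ gs)⁻¹
  rw [popGram_inv_transpose hV] at hmap
  refine tendstoInDistribution_of_tendstoInMeasure_sub _ _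
    (TendstoInDistribution.id_of_map_eq hslutsky hmap) ?_
    (S.aemeasurable_sqrt_smul_betaHat_sub β)
  refine tendstoInMeasure_congr_off (Y := fun _ _ => 0) (fun ε hε => by simp [hε.ne'])
    (tendsto_measure_singular hΓ hA) ?_
  filter_upwards [eventually_ge_atTop 1] with n hn ω hω
  have hunit : IsUnit (gramSum (fit G lab W n ω) (lab n ω) (sample W n ω)).det := not_not.1 hω
  exact sub_eq_zero.2 (sqrt_smul_betaHat_sub_eq (fit F lab W n ω) (fit G lab W n ω) β (lab n ω)
    (sample W n ω) (by omega) hunit)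

/-- Consistency of the estimator. -/
theorem betaHat_sub_tendsto_zero (S : CrossFitting P W μ lab F G)
    (C : ConsistentScore P W μ lab F G fs gs β)
    (hΓ : TendstoInMeasure P (fun n ω =>
      ((2 * n : ℕ) : ℝ)⁻¹ • gramSum (fit G lab W n ω) (lab n ω) (sample W n ω)) atTop
      fun _ => popGram μ gs) (hA : IsUnit (popGram μ gs).det) :
    TendstoInMeasure P (fun n ω =>
      betaHat (fit F lab W n ω) (fit G lab W n ω) (lab n ω) (sample W n ω) - β)
      atTop fun _ => 0 := by
  have h := tendstoInMeasure_comp_continuousAt (tendstoInMeasure_prodMk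
    (S.average_score_tendsto_zero C)
    (tendstoInMeasure_comp_continuousAt hΓ (continuousAt_matrix_inv hA)))
    continuous_toEuclideanCLM_apply.continuousAt
  simp only [map_zero] at h
  refine tendstoInMeasure_congr_off h (tendsto_measure_singular hΓ hA) ?_
  filter_upwards [eventually_ge_atTop 1] with n hn ω hω
  have hunit : IsUnit (gramSum (fit G lab W n ω) (lab n ω) (sample W n ω)).det := not_not.1 hω
  have hN : ((2 * n : ℕ) : ℝ) ≠ 0 := by
    exact_mod_cast (by omega : 2 * n ≠ 0)
  rw [betaHat_sub_eq _ _ β _ _ hunit, inv_smul_inv hN, map_smul, map_smul, smul_apply, smul_smul,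
    inv_mul_cancel₀ hN, one_smul]

/-- Consistency of the middle factor of the plug-in covariance. -/
theorem meat_tendsto (S : CrossFitting P W μ lab F G)
    (C : ConsistentScore P W μ lab F G fs gs β)
    (hb : ∀ k, BoundedInProbability P fun n ω =>
      eLpNorm (fun w : Obs q => fit G lab W n ω k w.2) 4 μ)
    (hβ : TendstoInMeasure P (fun n ω =>
      betaHat (fit F lab W n ω) (fit G lab W n ω) (lab n ω) (sample W n ω) - β)
      atTop fun _ => 0) :
    TendstoInMeasure P (fun n ω => ((2 * n : ℕ) : ℝ)⁻¹ •
      meatSum (fit F lab W n ω) (fit G lab W n ω) (lab n ω) (sample W n ω)) atTop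
      fun _ => popMeat μ fs gs β := by
  simp only [popMeat_eq, meatSum_eq]
  refine tendstoInMeasure_average_outer S.law S.indep C.measurable_score C.memLp ?_
  have hbdd := crossFitAverage_bounded S.law S.indep S.measurable_lab S.card_fold S.indep_lab
    (A := fun n k T x w => G n k T x w.2) (fun n k T =>
      (S.measurable_G n k T).comp (f := fun z : (T → Obs q) × Obs q => (z.1, z.2.2))
        (by fun_prop)) 4 fun k => by
    simp only [lintegral_enorm_pow _ four_ne_zero]
    exact (hb k).pow 4
  have hprod := hbdd.mul_vanishes
    ((vanishesInProbability_of_tendstoInMeasure hβ).pow two_ne_zero)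
  have hrem : TendstoInMeasure P (fun n ω => (((2 * n : ℕ) : ℝ)⁻¹ *
      ∑ i : Fin (2 * n), ‖fit G lab W n ω (lab n ω i) (W i ω).2‖ ^ 4) *
        ‖betaHat (fit F lab W n ω) (fit G lab W n ω) (lab n ω) (sample W n ω) - β‖ ^ 2)
      atTop fun _ => 0 := by
    refine VanishesInProbability.tendstoInMeasure (hprod.mono fun n ω => ?_)
    rw [abs_of_nonneg (by positivity), ENNReal.ofReal_mul (by positivity),
      ENNReal.ofReal_pow (norm_nonneg _), ofReal_norm]
    exact le_rfl
  have hbound := tendstoInMeasure_comp_continuousAt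
    (tendstoInMeasure_prodMk (S.average_scoreDiff_tendsto C) hrem)
    (φ := fun z : ℝ × ℝ => 2 * z.1 + 2 * z.2) (by fun_prop)
  simp only [mul_zero, add_zero] at hbound
  refine tendstoInMeasure_of_le_off (B := fun _ => ∅) hbound (by simp)
    (Eventually.of_forall fun n ω _ => ?_)
  rw [edist_zero_right, ← ofReal_norm, Real.norm_of_nonneg (by positivity)]
  refine ENNReal.ofReal_le_ofReal ?_
  set δ := betaHat (fit F lab W n ω) (fit G lab W n ω) (lab n ω) (sample W n ω) - β with hδ
  have hterm (i : Fin (2 * n)) :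
      ‖score (fit F lab W n ω (lab n ω i)) (fit G lab W n ω (lab n ω i))
        (betaHat (fit F lab W n ω) (fit G lab W n ω) (lab n ω) (sample W n ω)) (W i ω) -
          score fs gs β (W i ω)‖ ^ 2 ≤
      2 * ‖scoreHat F G lab W β n ω i - score fs gs β (W i ω)‖ ^ 2 +
        2 * (‖fit G lab W n ω (lab n ω i) (W i ω).2‖ ^ 4 * ‖δ‖ ^ 2) := by
    rw [score_eq_sub _ _ β, sub_right_comm]
    set a := scoreHat F G lab W β n ω i - score fs gs β (W i ω)
    set v := fit G lab W n ω (lab n ω i) (W i ω).2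
    have h1 : ‖inner ℝ v δ • v‖ ≤ ‖v‖ ^ 2 * ‖δ‖ := by
      rw [norm_smul]
      calc ‖inner ℝ v δ‖ * ‖v‖ ≤ (‖v‖ * ‖δ‖) * ‖v‖ := by
            gcongr
            exact norm_inner_le_norm v δ
        _ = _ := by ring
    have h2 : ‖a - inner ℝ v δ • v‖ ≤ ‖a‖ + ‖v‖ ^ 2 * ‖δ‖ :=
      (norm_sub_le _ _).trans (by gcongr)
    calc ‖a - inner ℝ v δ • v‖ ^ 2 ≤ (‖a‖ + ‖v‖ ^ 2 * ‖δ‖) ^ 2 := by gcongr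
      _ ≤ 2 * ‖a‖ ^ 2 + 2 * (‖v‖ ^ 4 * ‖δ‖ ^ 2) := by
          nlinarith [sq_nonneg (‖a‖ - ‖v‖ ^ 2 * ‖δ‖)]
  have hc : (0 : ℝ) ≤ ((2 * n : ℕ) : ℝ)⁻¹ := by positivity
  refine (mul_le_mul_of_nonneg_left (Finset.sum_le_sum fun i _ => hterm i) hc).trans_eq ?_
  rw [Finset.sum_add_distrib, ← Finset.mul_sum, ← Finset.mul_sum, ← Finset.sum_mul]
  ring

end CrossFitting

end SSLS

theorem theorem3 {Ω : Type*} [MeasurableSpace Ω] (P : Measure Ω) [IsProbabilityMeasure P]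
    {q d : ℕ}
    -- i.i.d. observations `(Z i, V i)` with common law `μ`
    (Z : ℕ → Ω → ℝ) (V : ℕ → Ω → SSLS.Vec q) (μ : Measure (SSLS.Obs q))
    (hlaw : ∀ i, HasLaw (fun ω => (Z i ω, V i ω)) μ P)
    (hindep : iIndepFun (fun i ω => (Z i ω, V i ω)) P)
    -- true transformations and the coefficient
    (fs : SSLS.Obs q → ℝ) (hfs : Measurable fs)
    (gs : SSLS.Vec q → SSLS.Vec d) (hgs : Measurable gs)
    (β : SSLS.Vec d)
    -- random split of the sample of size `N = 2 n` into two halves, independent of the sample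
    (lab : ∀ n : ℕ, Ω → Fin (2 * n) → Fin 2) (hlab : ∀ n, Measurable (lab n))
    (hlab_card : ∀ n ω k, (SSLS.fold (lab n ω) k).card = n)
    (hlab_indep : ∀ n, IndepFun (lab n) (fun ω (i : Fin (2 * n)) => (Z i ω, V i ω)) P)
    -- estimation procedures and the functions `f̂ₖ`, `ĝₖ` they produce from the complement of fold `k`
    (F : ∀ n : ℕ, Fin 2 → SSLS.Learner (2 * n) q (SSLS.Obs q) ℝ)
    (hF : ∀ n k T, Measurable (Function.uncurry (F n k T)))
    (G : ∀ n : ℕ, Fin 2 → SSLS.Learner (2 * n) q (SSLS.Vec q) (SSLS.Vec d))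
    (hG : ∀ n k T, Measurable (Function.uncurry (G n k T)))
    (data : ∀ n : ℕ, Ω → Fin (2 * n) → SSLS.Obs q)
    (hdata : data = fun n ω (i : Fin (2 * n)) => (Z i ω, V i ω))
    (fhat : ∀ n : ℕ, Ω → Fin 2 → SSLS.Obs q → ℝ)
    (hfhat : fhat = fun n ω => SSLS.crossFit (F n) (lab n ω) (data n ω))
    (ghat : ∀ n : ℕ, Ω → Fin 2 → SSLS.Vec q → SSLS.Vec d)
    (hghat : ghat = fun n ω => SSLS.crossFit (G n) (lab n ω) (data n ω))
    -- marginal orthogonality `E(ε V*) = 0`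
    (horth : ∫ w, SSLS.resid fs gs β w • gs w.2 ∂μ = 0)
    -- (a) moments and full rank
    (ha_V : MemLp (fun w : SSLS.Obs q => gs w.2) 4 μ)
    (ha_Veps : MemLp (fun w => SSLS.resid fs gs β w • gs w.2) 4 μ)
    (ha_eps : Integrable (fun w => SSLS.resid fs gs β w ^ 2) μ ∧
      ∃ C : ℝ, ∀ᵐ w ∂μ, (μ[fun w => SSLS.resid fs gs β w ^ 2 |
        MeasurableSpace.comap (fun w : SSLS.Obs q => gs w.2) inferInstance]) w ≤ C)
    (ha_rank : (SSLS.popGram μ gs).rank = d)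
    -- (b) bounded fourth moments of `ĝₖ`
    (hb : ∀ k, SSLS.BoundedInProbability P
      (fun n ω => eLpNorm (fun w : SSLS.Obs q => ghat n ω k w.2) 4 μ))
    -- (c) consistency of `f̂ₖ` and `ĝₖ`
    (hc_f : ∀ k, SSLS.VanishesInProbability P
      (fun n ω => eLpNorm (fun w => fhat n ω k w - fs w) 2 μ))
    (hc_g : ∀ k, SSLS.VanishesInProbability P
      (fun n ω => eLpNorm (fun w : SSLS.Obs q => ghat n ω k w.2 - gs w.2) 2 μ))
    -- (d) consistent estimation of the normal equations; the conditional expectation given the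
    -- training sample is the integral over a fresh observation with `f̂ₖ`, `ĝₖ` held fixed
    (hd_mean : ∀ k, TendstoInMeasure P
      (fun n ω => √((2 * n : ℕ) : ℝ) * ‖∫ w, SSLS.score (fhat n ω k) (ghat n ω k) β w ∂μ‖)
      atTop (fun _ => 0))
    (hd_norm : ∀ k, SSLS.VanishesInProbability P
      (fun n ω => eLpNorm
        (fun w => SSLS.score (fhat n ω k) (ghat n ω k) β w - SSLS.score fs gs β w) 2 μ)) :
    -- the estimator is well defined with probability tending to one
    Tendsto (fun n => P {ω | IsUnit (SSLS.gramSum (ghat n ω) (lab n ω) (data n ω)).det})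
      atTop (𝓝 1) ∧
    -- asymptotic normality
    TendstoInDistribution
      (fun n ω => √((2 * n : ℕ) : ℝ) •
        (SSLS.betaHat (fhat n ω) (ghat n ω) (lab n ω) (data n ω) - β))
      atTop id (fun _ => P) (multivariateGaussian 0 (SSLS.popSandwich μ fs gs β)) ∧
    -- consistency of the plug-in covariance estimate, in spectral norm
    TendstoInMeasure P
      (fun n ω => SSLS.sandwichHat (fhat n ω) (ghat n ω) (lab n ω) (data n ω))
      atTop (fun _ => SSLS.popSandwich μ fs gs β) ∧
    -- asymptotic normality with the plug-in estimate in place of the covariance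
    (IsUnit (SSLS.popSandwich μ fs gs β).det →
      TendstoInDistribution
        (fun n ω => √((2 * n : ℕ) : ℝ) • Matrix.toEuclideanCLM (𝕜 := ℝ)
          (CFC.sqrt (SSLS.sandwichHat (fhat n ω) (ghat n ω) (lab n ω) (data n ω)))⁻¹
          (SSLS.betaHat (fhat n ω) (ghat n ω) (lab n ω) (data n ω) - β))
        atTop id (fun _ => P) (multivariateGaussian 0 (1 : Matrix (Fin d) (Fin d) ℝ))) := by
  subst hdata hfhat hghat
  have : IsProbabilityMeasure μ := by
    rw [← (hlaw 0).map_eq]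
    exact Measure.isProbabilityMeasure_map (hlaw 0).aemeasurable
  have S : SSLS.CrossFitting P (fun i ω => (Z i ω, V i ω)) μ lab F G :=
    ⟨hlaw, hindep, hlab, hlab_card, hlab_indep, hF, hG⟩
  have C : SSLS.ConsistentScore P (fun i ω => (Z i ω, V i ω)) μ lab F G fs gs β :=
    ⟨hfs, hgs, ha_Veps.mono_exponent (by norm_num), horth, hd_mean, hd_norm⟩
  have hV : MemLp (fun w : SSLS.Obs q => gs w.2) 2 μ := ha_V.mono_exponent (by norm_num)
  have hA := SSLS.isUnit_det_of_rank_eq ha_rank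
  have hΓ := S.gram_tendsto hgs hV hc_g
  have hdist := S.betaHat_tendstoInDistribution C hV hΓ hA
  have hcov := SSLS.CrossFitting.sandwichHat_tendsto hΓ hA
    (S.meat_tendsto C hb (S.betaHat_sub_tendsto_zero C hΓ hA))
  have hdet := SSLS.CrossFitting.tendsto_measure_isUnit_det hΓ hA
  have hpos := SSLS.CrossFitting.popSandwich_posSemidef C hV
  exact ⟨hdet, hdist, hcov, fun hunit =>
    S.studentized_tendstoInDistribution hpos hunit hcov hdist⟩
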